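/- Let $H_{\mathbb R}$ be a separable real Hilbert space with $\dim H_{\mathbb R}\ge 2$, let $H$ be its complexification (inner product linear in the second variable), and let $x\mapsto\bar x$ be a self-adjoint complex-linear involution of $H$, i.e. $\bar{\bar x}=x$ and $\langle\bar x,y\rangle=\langle x,\bar y\rangle$. Let $\alpha,q\in(-1,1)$. Let $\Sigma(n)$ be the group of bijections $\sigma$ of $\{\pm1,\dots,\pm n\}$ with $\sigma(-k)=-\sigma(k)$, generated by $\pi_0=(1,-1)$ and $\pi_i=(i,i+1)$ (exchanging also $-i$ and $-(i+1)$), $1\le i\le n-1$. For $\sigma\in\Sigma(n)$ let $l_1(\sigma)$ be the number of letters $\pi_0$, and $l_2(\sigma)$ the number of letters $\pi_i$ with $i\ge1$, in an expression of $\sigma$ of minimal length in these generators (these numbers do not depend on the expression). The group $\Sigma(n)$ acts on $H^{\otimes n}$: $\pi_i$ exchanges the $i$-th and $(i+1)$-st tensor factors, and $\pi_0(x_1\otimes\cdots\otimes x_n)=\overline{x_1}\otimes x_2\otimes\cdots\otimes x_n$. On the algebraic full Fock space $\mathcal F=\bigoplus_{n\ge0}H^{\otimes n}$, $H^{\otimes0}=\mathbb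 C\Omega$, with the standard inner product $\langle\cdot,\cdot\rangle_{0,0}$, put $$\langle f,g\rangle_{\alpha,q}=\sum_{n\ge0}\Big\langle f_n,\ \sum_{\sigma\in\Sigma(n)}\alpha^{l_1(\sigma)}q^{l_2(\sigma)}\,\sigma g_n\Big\rangle_{0,0}\qquad(0^0=1),$$ where $f_n,g_n$ are the components in $H^{\otimes n}$; this is a (semi-)inner product. Let $\overline{\mathcal F}$ be the Hilbert space completion of $\mathcal F$ for it. For $x\in H$ let $B^*(x)$ be the right creation operator, $B^*(x)\Omega=x$, $B^*(x)(x_1\otimes\cdots\otimes x_n)=x_1\otimes\cdots\otimes x_n\otimes x$, let $B(x)$ be its adjoint with respect to $\langle\cdot,\cdot\rangle_{\alpha,q}$, and put $G(x)=B(x)+B^*(x)$. Then for every $x\in H_{\mathbb R}$ the creation operator $B^*(x)$ extends to a bounded operator on $\overline{\mathcal F}$, so that $G(x)$ is a well-defined bounded operator on $\overline{\mathcal F}$. Moreover, the vacuum state $T\mapsto\langle\Omega,T\Omega\rangle_{\alpha,q}$ is a trace on the von Neumann algebra generated by $\{G(x):x\in H_{\mathbb R}\}$ on $\overline{\mathcal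 F}$, that is, $\langle\Omega,ST\Omega\rangle_{\alpha,q}=\langle\Omega,TS\Omega\rangle_{\alpha,q}$ for all $S,T$ in it, if and only if $\alpha=0$. -/

import Mathlib

open scoped TensorProduct ComplexOrder

namespace TypeB

/-! ### The hyperoctahedral group -/

/-- The points `±1, …, ±n`: the pair `(k, s)` stands for `s (k + 1)`. -/
abbrev SignedIndex (n : ℕ) : Type := Fin n × ℤˣ

/-- The negation `p ↦ -p` of the points `±1, …, ±n`. -/
def SignedIndex.opp {n : ℕ} (p : SignedIndex n) : SignedIndex n := (p.1, -p.2)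

/-- The Coxeter group of type B: the bijections `σ` of `±1, …, ±n` with `σ (-k) = -σ k`. -/
def Hyperoctahedral (n : ℕ) : Subgroup (Equiv.Perm (SignedIndex n)) where
  carrier := {σ | ∀ p, σ p.opp = (σ p).opp}
  mul_mem' {a b} ha hb p := by
    simp only [Set.mem_ofPred_eq] at ha hb
    simp [Equiv.Perm.mul_apply, ha, hb]
  one_mem' p := rfl
  inv_mem' {a} ha p := by
    simp only [Set.mem_ofPred_eq] at ha
    apply a.injective
    simp [ha]

/-- The generators: `simpleReflection 0` exchanges `1` and `-1`, and for `1 ≤ i ≤ n - 1` the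
element `simpleReflection i` exchanges `i` with `i + 1` and `-i` with `-(i + 1)`. -/
def simpleReflection {n : ℕ} (i : Fin n) : Hyperoctahedral n :=
  if (i : ℕ) = 0 then
    ⟨Equiv.swap (i, 1) (i, -1), by
      intro p
      simp only [SignedIndex.opp, Equiv.swap_apply_def]
      obtain ⟨k, s⟩ := p
      rcases Int.units_eq_one_or s with rfl | rfl <;> by_cases h : k = i <;> simp [h]⟩
  else
    ⟨Equiv.prodCongr (Equiv.swap ⟨(i : ℕ) - 1, by omega⟩ i) (Equiv.refl ℤˣ), fun p => rfl⟩

/-- The product `π_{i₁} ⋯ π_{i_k}` of a word in the generators. -/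
def wordProd {n : ℕ} (w : List (Fin n)) : Hyperoctahedral n := (w.map simpleReflection).prod

/-- `w` is an irreducible form of `σ`: an expression of `σ` of minimal length. -/
def IsReducedWord {n : ℕ} (σ : Hyperoctahedral n) (w : List (Fin n)) : Prop :=
  wordProd w = σ ∧ ∀ w' : List (Fin n), wordProd w' = σ → w.length ≤ w'.length

/-- The number of letters `π₀` in a word. -/
def countZero {n : ℕ} (w : List (Fin n)) : ℕ := w.countP fun i => (i : ℕ) = 0

/-- The number of letters `π_i`, `i ≥ 1`, in a word. -/
def countPos {n : ℕ} (w : List (Fin n)) : ℕ := w.countP fun i => (i : ℕ) ≠ 0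

lemma countZero_cons {n : ℕ} (i : Fin n) (w : List (Fin n)) :
    countZero (i :: w) = countZero w + if (i : ℕ) = 0 then 1 else 0 := by
  by_cases h : (i : ℕ) = 0 <;> simp [countZero, h]

lemma countPos_cons {n : ℕ} (i : Fin n) (w : List (Fin n)) :
    countPos (i :: w) = countPos w + if (i : ℕ) = 0 then 0 else 1 := by
  by_cases h : (i : ℕ) = 0 <;> simp [countPos, h]

lemma countZero_concat {n : ℕ} (i : Fin n) (w : List (Fin n)) :
    countZero (w ++ [i]) = countZero w + if (i : ℕ) = 0 then 1 else 0 := by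
  by_cases h : (i : ℕ) = 0 <;> simp [countZero, h]

lemma countPos_concat {n : ℕ} (i : Fin n) (w : List (Fin n)) :
    countPos (w ++ [i]) = countPos w + if (i : ℕ) = 0 then 0 else 1 := by
  by_cases h : (i : ℕ) = 0 <;> simp [countPos, h]

lemma countZero_add_countPos {n : ℕ} (w : List (Fin n)) :
    countZero w + countPos w = w.length := by
  induction w with
  | nil => rfl
  | cons i w ih =>
    rw [countZero_cons, countPos_cons, List.length_cons]
    by_cases h : (i : ℕ) = 0 <;> simp [h] <;> omega

/-! #### Counting separating hyperplanes -/

/-- The integer `s (k + 1)` that the pair `(k, s)` stands for. -/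
def SignedIndex.val {n : ℕ} (p : SignedIndex n) : ℤ := (p.2 : ℤ) * ((p.1 : ℕ) + 1)

lemma hyp_opp {n : ℕ} (σ : Hyperoctahedral n) (p : SignedIndex n) :
    (σ : Equiv.Perm (SignedIndex n)) p.opp = ((σ : Equiv.Perm (SignedIndex n)) p).opp := σ.2 p

lemma SignedIndex.val_opp {n : ℕ} (p : SignedIndex n) : p.opp.val = -p.val := by
  simp [SignedIndex.opp, SignedIndex.val]

lemma hyp_fst_eq {n : ℕ} (σ : Hyperoctahedral n) (p q : SignedIndex n) :
    ((σ : Equiv.Perm (SignedIndex n)) p).1 = ((σ : Equiv.Perm (SignedIndex n)) q).1 ↔ p.1 = q.1 := by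
  have key : ∀ (τ : Hyperoctahedral n) (p q : SignedIndex n), p.1 = q.1 →
      ((τ : Equiv.Perm (SignedIndex n)) p).1 = ((τ : Equiv.Perm (SignedIndex n)) q).1 := by
    intro τ p q h
    have : p = q ∨ p = q.opp := by
      obtain ⟨k, s⟩ := p
      obtain ⟨l, t⟩ := q
      simp only at h
      subst h
      rcases Int.units_eq_one_or s with rfl | rfl <;>
        rcases Int.units_eq_one_or t with rfl | rfl <;> simp [SignedIndex.opp]
    rcases this with rfl | rfl
    · rfl
    · rw [hyp_opp]; rfl
  refine ⟨fun h => ?_, key σ p q⟩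
  simpa using key σ⁻¹ _ _ h

/-- Do `σ` and `τ` lie on different sides of the hyperplane of the point `a`? -/
def sep₁ {n : ℕ} (σ τ : Hyperoctahedral n) (a : SignedIndex n) : Prop :=
  ¬ (((σ⁻¹ : Hyperoctahedral n) : Equiv.Perm (SignedIndex n)) a).2 = (((τ⁻¹ : Hyperoctahedral n) : Equiv.Perm (SignedIndex n)) a).2

/-- Do `σ` and `τ` order the points `a` and `b` differently? -/
def sep₂ {n : ℕ} (σ τ : Hyperoctahedral n) (a b : SignedIndex n) : Prop :=
  ¬ ((((σ⁻¹ : Hyperoctahedral n) : Equiv.Perm (SignedIndex n)) a).val < (((σ⁻¹ : Hyperoctahedral n) : Equiv.Perm (SignedIndex n)) b).val ↔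
    (((τ⁻¹ : Hyperoctahedral n) : Equiv.Perm (SignedIndex n)) a).val < (((τ⁻¹ : Hyperoctahedral n) : Equiv.Perm (SignedIndex n)) b).val)

open Classical in
/-- Twice the number of hyperplanes `x_k = 0` that separate `σ` and `τ`. -/
noncomputable def sepCard₁ {n : ℕ} (σ τ : Hyperoctahedral n) : ℕ :=
  (Finset.univ.filter fun a : SignedIndex n => sep₁ σ τ a).card

open Classical in
/-- Four times the number of hyperplanes `x_j = ± x_k`, `j ≠ k`, that separate `σ` and `τ`. -/
noncomputable def sepCard₂ {n : ℕ} (σ τ : Hyperoctahedral n) : ℕ :=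
  (Finset.univ.filter fun p : SignedIndex n × SignedIndex n =>
    p.1.1 ≠ p.2.1 ∧ sep₂ σ τ p.1 p.2).card

lemma sepCard₁_mul_left {n : ℕ} (ρ σ τ : Hyperoctahedral n) :
    sepCard₁ (ρ * σ) (ρ * τ) = sepCard₁ σ τ := by
  classical
  unfold sepCard₁
  refine Finset.card_bij (fun a _ => ((ρ⁻¹ : Hyperoctahedral n) : Equiv.Perm (SignedIndex n)) a) ?_ ?_ ?_
  · intro a ha
    simp only [Finset.mem_filter, Finset.mem_univ, true_and] at ha ⊢
    simpa [sep₁, mul_inv_rev] using ha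
  · intro a _ b _ h
    exact Equiv.injective _ h
  · intro b hb
    refine ⟨(ρ : Equiv.Perm (SignedIndex n)) b, ?_, by simp⟩
    simp only [Finset.mem_filter, Finset.mem_univ, true_and] at hb ⊢
    simpa [sep₁, mul_inv_rev] using hb

lemma sepCard₂_mul_left {n : ℕ} (ρ σ τ : Hyperoctahedral n) :
    sepCard₂ (ρ * σ) (ρ * τ) = sepCard₂ σ τ := by
  classical
  unfold sepCard₂
  refine Finset.card_bij (fun p _ => (((ρ⁻¹ : Hyperoctahedral n) : Equiv.Perm (SignedIndex n)) p.1,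
    ((ρ⁻¹ : Hyperoctahedral n) : Equiv.Perm (SignedIndex n)) p.2)) ?_ ?_ ?_
  · intro a ha
    simp only [Finset.mem_filter, Finset.mem_univ, true_and, ne_eq, hyp_fst_eq] at ha ⊢
    simpa [sep₂, mul_inv_rev] using ha
  · intro a _ b _ h
    simp only [Prod.mk.injEq, EmbeddingLike.apply_eq_iff_eq] at h
    exact Prod.ext h.1 h.2
  · intro b hb
    refine ⟨((ρ : Equiv.Perm (SignedIndex n)) b.1, (ρ : Equiv.Perm (SignedIndex n)) b.2), ?_, by simp⟩
    simp only [Finset.mem_filter, Finset.mem_univ, true_and, ne_eq, hyp_fst_eq] at hb ⊢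
    simpa [sep₂, mul_inv_rev] using hb

lemma sepCard₁_triangle {n : ℕ} (ρ σ τ : Hyperoctahedral n) :
    sepCard₁ ρ τ ≤ sepCard₁ ρ σ + sepCard₁ σ τ := by
  classical
  unfold sepCard₁
  refine le_trans (Finset.card_le_card ?_) (Finset.card_union_le _ _)
  intro a ha
  simp only [Finset.mem_filter, Finset.mem_univ, true_and, Finset.mem_union] at ha ⊢
  unfold sep₁ at *
  by_contra hc
  push Not at hc
  exact ha (hc.1.trans hc.2)

lemma sepCard₂_triangle {n : ℕ} (ρ σ τ : Hyperoctahedral n) :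
    sepCard₂ ρ τ ≤ sepCard₂ ρ σ + sepCard₂ σ τ := by
  classical
  unfold sepCard₂
  refine le_trans (Finset.card_le_card ?_) (Finset.card_union_le _ _)
  intro a ha
  simp only [Finset.mem_filter, Finset.mem_univ, true_and, Finset.mem_union] at ha ⊢
  unfold sep₂ at *
  tauto

lemma simpleReflection_zero_apply {n : ℕ} (i : Fin n) (hi : (i : ℕ) = 0) (p : SignedIndex n) :
    ((simpleReflection i : Hyperoctahedral n) : Equiv.Perm (SignedIndex n)) p =
      if p.1 = i then p.opp else p := by
  obtain ⟨k, s⟩ := p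
  simp only [simpleReflection, hi, if_true, Equiv.swap_apply_def, SignedIndex.opp]
  rcases Int.units_eq_one_or s with rfl | rfl <;> by_cases h : k = i <;> simp [h]

lemma simpleReflection_pos_apply {n : ℕ} (i : Fin n) (hi : (i : ℕ) ≠ 0) (p : SignedIndex n) :
    ((simpleReflection i : Hyperoctahedral n) : Equiv.Perm (SignedIndex n)) p =
      (Equiv.swap ⟨(i : ℕ) - 1, by omega⟩ i p.1, p.2) := by
  simp [simpleReflection, hi, Equiv.prodCongr, Prod.map]

lemma simpleReflection_mul_self {n : ℕ} (i : Fin n) :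
    simpleReflection i * simpleReflection i = 1 := by
  apply Subtype.ext
  ext1 p
  by_cases hi : (i : ℕ) = 0
  · simp only [Subgroup.coe_mul, Equiv.Perm.mul_apply, simpleReflection_zero_apply i hi]
    obtain ⟨k, s⟩ := p
    by_cases h : k = i <;> simp [h, SignedIndex.opp]
  · simp [Subgroup.coe_mul, Equiv.Perm.mul_apply, simpleReflection_pos_apply i hi]

lemma simpleReflection_inv {n : ℕ} (i : Fin n) :
    (simpleReflection i)⁻¹ = simpleReflection i :=
  inv_eq_of_mul_eq_one_left (simpleReflection_mul_self i)

lemma SignedIndex.val_injective {n : ℕ} :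
    Function.Injective (SignedIndex.val : SignedIndex n → ℤ) := by
  rintro ⟨k, s⟩ ⟨l, t⟩ h
  simp only [SignedIndex.val] at h
  rcases Int.units_eq_one_or s with rfl | rfl <;>
    rcases Int.units_eq_one_or t with rfl | rfl <;> simp [Fin.ext_iff] at h ⊢ <;> omega

/-- For the generator `π₀` only the hyperplane `x_1 = 0` separates. -/
lemma sep₁_one_zero {n : ℕ} (i : Fin n) (hi : (i : ℕ) = 0) (a : SignedIndex n) :
    sep₁ 1 (simpleReflection i) a ↔ a.1 = i := by
  simp only [sep₁, simpleReflection_inv, simpleReflection_zero_apply i hi]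
  obtain ⟨k, s⟩ := a
  by_cases h : k = i <;> simp [h, SignedIndex.opp]

lemma sep₁_one_pos {n : ℕ} (i : Fin n) (hi : (i : ℕ) ≠ 0) (a : SignedIndex n) :
    ¬ sep₁ 1 (simpleReflection i) a := by
  simp [sep₁, simpleReflection_inv, simpleReflection_pos_apply i hi]

lemma sep₂_one_zero {n : ℕ} (i : Fin n) (hi : (i : ℕ) = 0) (a b : SignedIndex n)
    (hab : a.1 ≠ b.1) : ¬ sep₂ 1 (simpleReflection i) a b := by
  simp only [sep₂, simpleReflection_inv, simpleReflection_zero_apply i hi, not_not]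
  obtain ⟨k, s⟩ := a
  obtain ⟨l, t⟩ := b
  simp only [ne_eq, Fin.ext_iff] at hab
  rcases Int.units_eq_one_or s with rfl | rfl <;>
    rcases Int.units_eq_one_or t with rfl | rfl <;>
    by_cases h : k = i <;> by_cases h' : l = i <;>
    simp [h, h', SignedIndex.opp, SignedIndex.val, Fin.ext_iff] at * <;> omega

lemma sep₂_one_pos {n : ℕ} (i j : Fin n) (hj : (j : ℕ) + 1 = i) (a b : SignedIndex n)
    (hab : a.1 ≠ b.1) : sep₂ 1 (simpleReflection i) a b ↔
      (a.2 = b.2 ∧ (a.1 = j ∧ b.1 = i ∨ a.1 = i ∧ b.1 = j)) := by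
  have hi : (i : ℕ) ≠ 0 := by omega
  have hj' : (⟨(i : ℕ) - 1, by omega⟩ : Fin n) = j := Fin.ext (by simp; omega)
  simp only [sep₂, simpleReflection_inv, simpleReflection_pos_apply i hi, hj',
    Equiv.swap_apply_def]
  obtain ⟨k, s⟩ := a
  obtain ⟨l, t⟩ := b
  have hij : i ≠ j := by rintro rfl; omega
  simp only [ne_eq] at hab
  rcases Int.units_eq_one_or s with rfl | rfl <;>
    rcases Int.units_eq_one_or t with rfl | rfl <;>
    by_cases h1 : k = i <;> by_cases h2 : l = i <;>
    by_cases h3 : k = j <;> by_cases h4 : l = j <;>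
    simp_all [SignedIndex.val, Fin.ext_iff] <;> omega

lemma sepCard₁_one_zero {n : ℕ} (i : Fin n) (hi : (i : ℕ) = 0) :
    sepCard₁ 1 (simpleReflection i) = 2 := by
  classical
  have : (Finset.univ.filter fun a : SignedIndex n => sep₁ 1 (simpleReflection i) a) =
      {(i, 1), (i, -1)} := by
    ext ⟨k, s⟩
    simp only [Finset.mem_filter, Finset.mem_univ, true_and, sep₁_one_zero i hi]
    rcases Int.units_eq_one_or s with rfl | rfl <;> simp
  rw [sepCard₁, this, Finset.card_pair (by simp)]

lemma sepCard₁_one_pos {n : ℕ} (i : Fin n) (hi : (i : ℕ) ≠ 0) :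
    sepCard₁ 1 (simpleReflection i) = 0 := by
  classical
  simp [sepCard₁, sep₁_one_pos i hi]

lemma sepCard₂_one_zero {n : ℕ} (i : Fin n) (hi : (i : ℕ) = 0) :
    sepCard₂ 1 (simpleReflection i) = 0 := by
  classical
  rw [sepCard₂, Finset.card_eq_zero, Finset.filter_eq_empty_iff]
  rintro ⟨a, b⟩ _ ⟨h1, h2⟩
  exact sep₂_one_zero i hi a b h1 h2

lemma sepCard₂_one_pos {n : ℕ} (i j : Fin n) (hj : (j : ℕ) + 1 = i) :
    sepCard₂ 1 (simpleReflection i) = 4 := by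
  classical
  have hij : i ≠ j := by rintro rfl; omega
  have : (Finset.univ.filter fun p : SignedIndex n × SignedIndex n =>
      p.1.1 ≠ p.2.1 ∧ sep₂ 1 (simpleReflection i) p.1 p.2) =
      {((i, 1), (j, 1)), ((j, 1), (i, 1)), ((i, -1), (j, -1)), ((j, -1), (i, -1))} := by
    ext ⟨⟨k, s⟩, ⟨l, t⟩⟩
    simp only [Finset.mem_filter, Finset.mem_univ, true_and]
    rw [and_congr_right (fun h => sep₂_one_pos i j hj (k, s) (l, t) h)]
    rcases Int.units_eq_one_or s with rfl | rfl <;>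
      rcases Int.units_eq_one_or t with rfl | rfl <;> simp <;> grind
  rw [sepCard₂, this]
  rw [Finset.card_insert_of_notMem, Finset.card_insert_of_notMem, Finset.card_pair] <;>
    simp [hij, hij.symm]

lemma sepCard_wordProd_le {n : ℕ} (w : List (Fin n)) :
    sepCard₁ 1 (wordProd w) ≤ 2 * countZero w ∧ sepCard₂ 1 (wordProd w) ≤ 4 * countPos w := by
  induction w with
  | nil => simp [wordProd, sepCard₁, sepCard₂, sep₁, sep₂]
  | cons i w ih =>
    have e : wordProd (i :: w) = simpleReflection i * wordProd w := by simp [wordProd]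
    have h1 := sepCard₁_triangle 1 (simpleReflection i) (simpleReflection i * wordProd w)
    have h2 := sepCard₂_triangle 1 (simpleReflection i) (simpleReflection i * wordProd w)
    have e1 := sepCard₁_mul_left (simpleReflection i) 1 (wordProd w)
    have e2 := sepCard₂_mul_left (simpleReflection i) 1 (wordProd w)
    rw [mul_one] at e1 e2
    rw [e1] at h1
    rw [e2] at h2
    rw [e]
    rw [countZero_cons, countPos_cons]
    by_cases hi : (i : ℕ) = 0
    · rw [sepCard₁_one_zero i hi] at h1
      rw [sepCard₂_one_zero i hi] at h2
      simp only [hi, if_true, if_false]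
      omega
    · rw [sepCard₁_one_pos i hi] at h1
      rw [sepCard₂_one_pos i ⟨(i : ℕ) - 1, by omega⟩ (by simp; omega)] at h2
      simp only [hi, if_true, if_false]
      omega

lemma exists_descent {n : ℕ} (σ : Hyperoctahedral n) (hσ : σ ≠ 1) :
    (∃ i : Fin n, (i : ℕ) = 0 ∧ ((σ : Equiv.Perm (SignedIndex n)) (i, 1)).2 = -1) ∨
    (∃ i j : Fin n, (j : ℕ) + 1 = i ∧
      ((σ : Equiv.Perm (SignedIndex n)) (i, 1)).val < ((σ : Equiv.Perm (SignedIndex n)) (j, 1)).val) := by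
  by_contra hc
  push Not at hc
  obtain ⟨h0, h1⟩ := hc
  apply hσ
  have step : ∀ i j : Fin n, (j : ℕ) + 1 = i →
      ((σ : Equiv.Perm (SignedIndex n)) (j, 1)).val < ((σ : Equiv.Perm (SignedIndex n)) (i, 1)).val := by
    intro i j hij
    refine lt_of_le_of_ne (h1 i j hij) fun h => ?_
    have := (σ : Equiv.Perm (SignedIndex n)).injective (SignedIndex.val_injective h)
    simp only [Prod.mk.injEq, and_true] at this
    subst this
    omega
  have low : ∀ m : ℕ, ∀ hm : m < n, (m : ℤ) + 1 ≤ ((σ : Equiv.Perm (SignedIndex n)) (⟨m, hm⟩, 1)).val := by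
    intro m
    induction m with
    | zero =>
      intro hm
      have := h0 ⟨0, hm⟩ rfl
      rcases Int.units_eq_one_or ((σ : Equiv.Perm (SignedIndex n)) (⟨0, hm⟩, 1)).2 with h | h
      · simp [SignedIndex.val, h]
      · exact absurd h this
    | succ m ih =>
      intro hm
      have := ih (by omega)
      have := step ⟨m + 1, hm⟩ ⟨m, by omega⟩ rfl
      push_cast
      omega
  have pos : ∀ k : Fin n, ((σ : Equiv.Perm (SignedIndex n)) (k, 1)).2 = 1 := by
    intro k
    rcases Int.units_eq_one_or ((σ : Equiv.Perm (SignedIndex n)) (k, 1)).2 with h | h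
    · exact h
    · have := low k k.2
      simp [SignedIndex.val, h] at this
      omega
  have mono : StrictMono fun k : Fin n => ((σ : Equiv.Perm (SignedIndex n)) (k, 1)).1 := by
    cases n with
    | zero => exact fun a => a.elim0
    | succ n =>
      refine Fin.strictMono_iff_lt_succ.2 fun k => ?_
      have := step k.succ k.castSucc (by simp)
      simp only [SignedIndex.val, pos] at this
      simp at this
      exact this
  have hid : ∀ k : Fin n, ((σ : Equiv.Perm (SignedIndex n)) (k, 1)).1 = k := by
    intro k
    exact congrFun (mono.eq_id) k
  have h1' : ∀ k : Fin n, (σ : Equiv.Perm (SignedIndex n)) (k, 1) = (k, 1) := fun k =>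
    Prod.ext (hid k) (pos k)
  apply Subtype.ext
  ext1 ⟨k, s⟩
  rcases Int.units_eq_one_or s with rfl | rfl
  · simp [h1']
  · have := hyp_opp σ (k, 1)
    simpa [SignedIndex.opp, h1'] using this

lemma sepCard₁_descent {n : ℕ} (σ : Hyperoctahedral n) (i : Fin n) (hi : (i : ℕ) = 0)
    (h : ((σ : Equiv.Perm (SignedIndex n)) (i, 1)).2 = -1) :
    sepCard₁ 1 (σ * simpleReflection i) + 2 ≤ sepCard₁ 1 σ := by
  classical
  have e := sepCard₁_mul_left σ 1 (simpleReflection i)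
  rw [mul_one, sepCard₁_one_zero i hi] at e
  rw [← e]
  unfold sepCard₁
  have key : ∀ a, sep₁ σ (σ * simpleReflection i) a → sep₁ 1 σ a := by
    intro a ha
    obtain ⟨⟨k, s⟩, rfl⟩ := (σ : Equiv.Perm (SignedIndex n)).surjective a
    have : k = i := by
      by_contra hk
      simp [sep₁, mul_inv_rev, simpleReflection_inv, simpleReflection_zero_apply i hi, hk] at ha
    subst this
    have ho := hyp_opp σ (k, 1)
    rcases Int.units_eq_one_or s with rfl | rfl
    · simp [sep₁, h]
    · have ho' : ((σ : Equiv.Perm (SignedIndex n)) (k, -1)).2 = 1 := by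
        have : SignedIndex.opp ((k, 1) : SignedIndex n) = (k, -1) := rfl
        rw [← this, ho]
        simp [SignedIndex.opp, h]
      simp [sep₁, ho']
  rw [← Finset.card_union_of_disjoint]
  · apply Finset.card_le_card
    intro a ha
    simp only [Finset.mem_filter, Finset.mem_univ, true_and, Finset.mem_union] at ha ⊢
    rcases ha with ha | ha
    · by_contra hc
      have h3 : sep₁ σ (σ * simpleReflection i) a := by
        unfold sep₁ at *
        intro h4
        push Not at hc
        exact ha (hc.trans h4)
      exact hc (key a h3)
    · exact key a ha
  · rw [Finset.disjoint_left]
    intro a ha hb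
    simp only [Finset.mem_filter, Finset.mem_univ, true_and] at ha hb
    have h3 := key a hb
    unfold sep₁ at *
    revert ha hb h3
    generalize (((1 : Hyperoctahedral n)⁻¹ : Hyperoctahedral n) : Equiv.Perm (SignedIndex n)) a = x
    generalize ((σ⁻¹ : Hyperoctahedral n) : Equiv.Perm (SignedIndex n)) a = y
    generalize (((σ * simpleReflection i)⁻¹ : Hyperoctahedral n) : Equiv.Perm (SignedIndex n)) a = z
    rcases Int.units_eq_one_or x.2 with hx | hx <;> rcases Int.units_eq_one_or y.2 with hy | hy <;>
      rcases Int.units_eq_one_or z.2 with hz | hz <;> simp [hx, hy, hz]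

lemma sepCard₂_descent {n : ℕ} (σ : Hyperoctahedral n) (i j : Fin n) (hj : (j : ℕ) + 1 = i)
    (h : ((σ : Equiv.Perm (SignedIndex n)) (i, 1)).val < ((σ : Equiv.Perm (SignedIndex n)) (j, 1)).val) :
    sepCard₂ 1 (σ * simpleReflection i) + 4 ≤ sepCard₂ 1 σ := by
  classical
  have e := sepCard₂_mul_left σ 1 (simpleReflection i)
  rw [mul_one, sepCard₂_one_pos i j hj] at e
  rw [← e]
  unfold sepCard₂
  have key : ∀ a b, a.1 ≠ b.1 → sep₂ σ (σ * simpleReflection i) a b → sep₂ 1 σ a b := by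
    intro a b hab ha
    obtain ⟨a, rfl⟩ := (σ : Equiv.Perm (SignedIndex n)).surjective a
    obtain ⟨b, rfl⟩ := (σ : Equiv.Perm (SignedIndex n)).surjective b
    rw [Ne, hyp_fst_eq] at hab
    have h2 : sep₂ 1 (simpleReflection i) a b := by
      simpa [sep₂, mul_inv_rev] using ha
    rw [sep₂_one_pos i j hj a b hab] at h2
    obtain ⟨k, s⟩ := a
    obtain ⟨l, t⟩ := b
    obtain ⟨rfl, h2⟩ : s = t ∧ (k = j ∧ l = i ∨ k = i ∧ l = j) := h2
    have hoi : (((σ : Equiv.Perm (SignedIndex n)) (i, -1))).val = -((σ : Equiv.Perm (SignedIndex n)) (i, 1)).val := by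
      rw [← SignedIndex.val_opp, ← hyp_opp]; rfl
    have hoj : (((σ : Equiv.Perm (SignedIndex n)) (j, -1))).val = -((σ : Equiv.Perm (SignedIndex n)) (j, 1)).val := by
      rw [← SignedIndex.val_opp, ← hyp_opp]; rfl
    have v1 : SignedIndex.val (i, 1) = (i : ℤ) + 1 := by simp [SignedIndex.val]
    have v2 : SignedIndex.val (j, 1) = (j : ℤ) + 1 := by simp [SignedIndex.val]
    have v3 : SignedIndex.val (i, -1) = -((i : ℤ) + 1) := by simp [SignedIndex.val]
    have v4 : SignedIndex.val (j, -1) = -((j : ℤ) + 1) := by simp [SignedIndex.val]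
    have hj' : (i : ℤ) = (j : ℤ) + 1 := by omega
    rcases h2 with ⟨rfl, rfl⟩ | ⟨rfl, rfl⟩ <;>
      rcases Int.units_eq_one_or s with rfl | rfl <;>
      simp [sep₂, hoi, hoj, v1, v2, v3, v4] <;> omega
  rw [← Finset.card_union_of_disjoint]
  · apply Finset.card_le_card
    rintro ⟨a, b⟩ ha
    simp only [Finset.mem_filter, Finset.mem_univ, true_and, Finset.mem_union] at ha ⊢
    rcases ha with ha | ha
    · refine ⟨ha.1, ?_⟩
      have := key a b ha.1
      unfold sep₂ at *
      tauto
    · exact ⟨ha.1, key a b ha.1 ha.2⟩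
  · rw [Finset.disjoint_left]
    rintro ⟨a, b⟩ ha hb
    simp only [Finset.mem_filter, Finset.mem_univ, true_and] at ha hb
    have h3 := key a b ha.1
    unfold sep₂ at *
    tauto

lemma exists_word {n : ℕ} (σ : Hyperoctahedral n) : ∃ w : List (Fin n), wordProd w = σ ∧
    2 * countZero w ≤ sepCard₁ 1 σ ∧ 4 * countPos w ≤ sepCard₂ 1 σ := by
  induction h : sepCard₁ 1 σ + sepCard₂ 1 σ using Nat.strong_induction_on generalizing σ with
  | _ N ih =>
  by_cases hσ : σ = 1
  · exact ⟨[], by simp [wordProd, hσ], by simp [countZero], by simp [countPos]⟩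
  have fin : ∀ i : Fin n, ∀ w, wordProd w = σ * simpleReflection i →
      wordProd (w ++ [i]) = σ := by
    intro i w hw
    have : wordProd (w ++ [i]) = wordProd w * simpleReflection i := by simp [wordProd]
    rw [this, hw, mul_assoc, simpleReflection_mul_self, mul_one]
  rcases exists_descent σ hσ with ⟨i, hi, hd⟩ | ⟨i, j, hj, hd⟩
  · have h1 := sepCard₁_descent σ i hi hd
    have h2 := sepCard₂_triangle 1 σ (σ * simpleReflection i)
    have e := sepCard₂_mul_left σ 1 (simpleReflection i)
    rw [mul_one, sepCard₂_one_zero i hi] at e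
    obtain ⟨w, hw, hw1, hw2⟩ := ih _ (by omega) (σ * simpleReflection i) rfl
    refine ⟨w ++ [i], fin i w hw, ?_, ?_⟩
    · rw [countZero_concat]
      simp only [hi, if_true, if_false]; omega
    · rw [countPos_concat]
      simp only [hi, if_true, if_false]; omega
  · have hi : (i : ℕ) ≠ 0 := by omega
    have h1 := sepCard₂_descent σ i j hj hd
    have h2 := sepCard₁_triangle 1 σ (σ * simpleReflection i)
    have e := sepCard₁_mul_left σ 1 (simpleReflection i)
    rw [mul_one, sepCard₁_one_pos i hi] at e
    obtain ⟨w, hw, hw1, hw2⟩ := ih _ (by omega) (σ * simpleReflection i) rfl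
    refine ⟨w ++ [i], fin i w hw, ?_, ?_⟩
    · rw [countZero_concat]
      simp only [hi, if_true, if_false]; omega
    · rw [countPos_concat]
      simp only [hi, if_true, if_false]; omega

lemma IsReducedWord.count_eq {n : ℕ} {σ : Hyperoctahedral n} {w : List (Fin n)}
    (hw : IsReducedWord σ w) :
    2 * countZero w = sepCard₁ 1 σ ∧ 4 * countPos w = sepCard₂ 1 σ := by
  obtain ⟨w', hw', h1, h2⟩ := exists_word σ
  have h3 := sepCard_wordProd_le w
  rw [hw.1] at h3
  have h4 := hw.2 w' hw'
  rw [← countZero_add_countPos, ← countZero_add_countPos] at h4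
  omega

lemma exists_isReducedWord {n : ℕ} (σ : Hyperoctahedral n) : ∃ w, IsReducedWord σ w := by
  obtain ⟨w, hw, h1, h2⟩ := exists_word σ
  refine ⟨w, hw, fun w' hw' => ?_⟩
  have h3 := sepCard_wordProd_le w'
  rw [hw'] at h3
  rw [← countZero_add_countPos, ← countZero_add_countPos]
  omega

/-- `l₁ σ`: the number of `π₀` in an irreducible form of `σ`. -/
noncomputable def l₁ {n : ℕ} (σ : Hyperoctahedral n) : ℕ :=
  countZero (exists_isReducedWord σ).choose

/-- `l₂ σ`: the number of `π_i`, `i ≥ 1`, in an irreducible form of `σ`. -/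
noncomputable def l₂ {n : ℕ} (σ : Hyperoctahedral n) : ℕ :=
  countPos (exists_isReducedWord σ).choose

lemma two_mul_l₁ {n : ℕ} (σ : Hyperoctahedral n) : 2 * l₁ σ = sepCard₁ 1 σ :=
  (exists_isReducedWord σ).choose_spec.count_eq.1

lemma four_mul_l₂ {n : ℕ} (σ : Hyperoctahedral n) : 4 * l₂ σ = sepCard₂ 1 σ :=
  (exists_isReducedWord σ).choose_spec.count_eq.2

/-- `l₁` and `l₂` do not depend on the chosen irreducible form. -/
lemma IsReducedWord.l_eq {n : ℕ} {σ : Hyperoctahedral n} {w : List (Fin n)}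
    (hw : IsReducedWord σ w) : countZero w = l₁ σ ∧ countPos w = l₂ σ := by
  have h := hw.count_eq
  have h1 := two_mul_l₁ σ
  have h2 := four_mul_l₂ σ
  omega

/-! #### The weights `α ^ l₁ * q ^ l₂` form a positive semidefinite kernel -/

lemma sum_signs (f : ℤˣ → ℕ) : ∑ s, f s = f 1 + f (-1) := by
  rw [show (Finset.univ : Finset ℤˣ) = {1, -1} from rfl, Finset.sum_pair (by decide)]

lemma sep₁_opp {n : ℕ} (σ τ : Hyperoctahedral n) (k : Fin n) :
    sep₁ σ τ (k, -1) ↔ sep₁ σ τ (k, 1) := by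
  have : ((k, -1) : SignedIndex n) = SignedIndex.opp (k, 1) := rfl
  simp only [sep₁, this, hyp_opp]
  simp [SignedIndex.opp]

lemma sep₂_opp {n : ℕ} (σ τ : Hyperoctahedral n) (a b : SignedIndex n) :
    sep₂ σ τ a.opp b.opp ↔ sep₂ σ τ b a := by
  simp only [sep₂, hyp_opp, SignedIndex.val_opp, neg_lt_neg_iff]

lemma sep₂_swap {n : ℕ} (σ τ : Hyperoctahedral n) (a b : SignedIndex n) (hab : a.1 ≠ b.1) :
    sep₂ σ τ b a ↔ sep₂ σ τ a b := by
  have key : ∀ ρ : Hyperoctahedral n,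
      ((ρ : Equiv.Perm (SignedIndex n)) b).val < ((ρ : Equiv.Perm (SignedIndex n)) a).val ↔
      ¬ ((ρ : Equiv.Perm (SignedIndex n)) a).val < ((ρ : Equiv.Perm (SignedIndex n)) b).val := by
    intro ρ
    have : ((ρ : Equiv.Perm (SignedIndex n)) a).val ≠ ((ρ : Equiv.Perm (SignedIndex n)) b).val := by
      intro h
      have := (ρ : Equiv.Perm (SignedIndex n)).injective (SignedIndex.val_injective h)
      exact hab (congrArg Prod.fst this)
    omega
  unfold sep₂
  rw [key, key]
  tauto

open Classical in
lemma sepCard₁_eq {n : ℕ} (σ τ : Hyperoctahedral n) :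
    sepCard₁ σ τ = 2 * ∑ k : Fin n, if sep₁ σ τ (k, 1) then 1 else 0 := by
  rw [sepCard₁, Finset.card_filter, Fintype.sum_prod_type, Finset.mul_sum]
  refine Finset.sum_congr rfl fun k _ => ?_
  rw [sum_signs]
  simp only [sep₁_opp]
  ring

open Classical in
lemma sepCard₂_eq {n : ℕ} (σ τ : Hyperoctahedral n) :
    sepCard₂ σ τ = 4 * ∑ p : Fin n × Fin n × ℤˣ,
      if p.1 < p.2.1 ∧ sep₂ σ τ (p.1, 1) p.2 then 1 else 0 := by
  set g : Fin n → Fin n → ℕ := fun i j =>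
    ∑ t : ℤˣ, if sep₂ σ τ (i, 1) (j, t) then 1 else 0 with hg
  have hsymm : ∀ i j, i ≠ j → g i j = g j i := by
    intro i j hij
    simp only [hg]
    rw [sum_signs, sum_signs]
    have e1 := sep₂_swap σ τ (i, 1) (j, 1) hij
    have e2 := sep₂_opp σ τ (i, 1) (j, -1)
    simp only [SignedIndex.opp, neg_neg] at e2
    have e3 := sep₂_swap σ τ (i, -1) (j, 1) hij
    have e4 := sep₂_swap σ τ (i, 1) (j, -1) hij
    simp only [e1, ← e4, ← e2, ← e3]
  have e : sepCard₂ σ τ = ∑ i, ∑ j, if i ≠ j then 2 * g i j else 0 := by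
    rw [sepCard₂, Finset.card_filter]
    simp only [Fintype.sum_prod_type]
    refine Finset.sum_congr rfl fun i _ => ?_
    rw [Finset.sum_comm]
    refine Finset.sum_congr rfl fun j _ => ?_
    by_cases hij : i = j
    · simp [hij]
    · simp only [hg, hij, ne_eq, not_false_eq_true, true_and, if_true]
      simp only [sum_signs]
      have e1 := sep₂_opp σ τ (i, 1) (j, 1)
      have e2 := sep₂_opp σ τ (i, 1) (j, -1)
      have e3 := sep₂_swap σ τ (i, 1) (j, 1) hij
      have e4 := sep₂_swap σ τ (i, 1) (j, -1) hij
      simp only [SignedIndex.opp, neg_neg] at e1 e2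
      simp only [e1, e2, e3, e4]
      ring
  have e' : (∑ p : Fin n × Fin n × ℤˣ,
      if p.1 < p.2.1 ∧ sep₂ σ τ (p.1, 1) p.2 then 1 else 0) =
      ∑ i, ∑ j, if i < j then g i j else 0 := by
    simp only [Fintype.sum_prod_type, hg]
    refine Finset.sum_congr rfl fun i _ => Finset.sum_congr rfl fun j _ => ?_
    by_cases hij : i < j <;> simp [hij]
  have e'' : (∑ i, ∑ j, if i < j then g i j else 0) = ∑ i, ∑ j, if j < i then g i j else 0 := by
    rw [Finset.sum_comm]
    refine Finset.sum_congr rfl fun i _ => Finset.sum_congr rfl fun j _ => ?_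
    by_cases hij : j < i
    · simp [hij, hsymm j i hij.ne]
    · simp [hij]
  have : sepCard₂ σ τ = 2 * (∑ i, ∑ j, if i < j then g i j else 0) +
      2 * ∑ i, ∑ j, if j < i then g i j else 0 := by
    rw [e]
    simp only [Finset.mul_sum, ← Finset.sum_add_distrib]
    refine Finset.sum_congr rfl fun i _ => Finset.sum_congr rfl fun j _ => ?_
    rcases lt_trichotomy i j with h | h | h
    · simp [h, h.ne, h.not_gt]
    · simp [h]
    · simp [h, h.ne', h.not_gt]
  rw [e', this, ← e'']
  ring

lemma l₁_inv_mul {n : ℕ} (σ τ : Hyperoctahedral n) : 2 * l₁ (σ⁻¹ * τ) = sepCard₁ σ τ := by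
  rw [two_mul_l₁, ← sepCard₁_mul_left σ]
  simp

lemma l₂_inv_mul {n : ℕ} (σ τ : Hyperoctahedral n) : 4 * l₂ (σ⁻¹ * τ) = sepCard₂ σ τ := by
  rw [four_mul_l₂, ← sepCard₂_mul_left σ]
  simp

lemma l₁_inv {n : ℕ} (σ : Hyperoctahedral n) : l₁ σ⁻¹ = l₁ σ := by
  have h1 := l₁_inv_mul σ 1
  have h2 := two_mul_l₁ σ
  have h3 : sepCard₁ σ 1 = sepCard₁ 1 σ := by
    unfold sepCard₁
    congr 1
    ext a
    simp only [Finset.mem_filter]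
    unfold sep₁
    tauto
  rw [mul_one] at h1
  omega

lemma l₂_inv {n : ℕ} (σ : Hyperoctahedral n) : l₂ σ⁻¹ = l₂ σ := by
  have h1 := l₂_inv_mul σ 1
  have h2 := four_mul_l₂ σ
  have h3 : sepCard₂ σ 1 = sepCard₂ 1 σ := by
    unfold sepCard₂
    congr 1
    ext p
    simp only [Finset.mem_filter]
    unfold sep₂
    tauto
  rw [mul_one] at h1
  omega

lemma posSemidef_prod {X I : Type*} [Fintype X] (s : Finset I) (M : I → Matrix X X ℂ)
    (hM : ∀ i ∈ s, (M i).PosSemidef) :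
    (Matrix.of fun x y => ∏ i ∈ s, M i x y).PosSemidef := by
  classical
  induction s using Finset.induction_on with
  | empty =>
    convert Matrix.posSemidef_vecMulVec_self_star (fun _ : X => (1 : ℂ)) using 1
    ext x y
    simp [Matrix.vecMulVec]
  | insert a s ha ih =>
    have h1 := (hM a (Finset.mem_insert_self a s)).hadamard
      (ih fun i hi => hM i (Finset.mem_insert_of_mem hi))
    have e : (Matrix.of fun x y => ∏ i ∈ insert a s, M i x y) =
        (M a).hadamard (Matrix.of fun x y => ∏ i ∈ s, M i x y) := by
      ext x y
      simp [Finset.prod_insert ha]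
    rw [e]
    exact h1

open Classical in
lemma posSemidef_ite {X : Type*} [Fintype X] (P : X → Prop) (c : ℝ) (hc : |c| ≤ 1) :
    (Matrix.of fun x y => if ¬ (P x ↔ P y) then (c : ℂ) else 1).PosSemidef := by
  obtain ⟨h1, h2⟩ := abs_le.1 hc
  have e1 := (Matrix.posSemidef_vecMulVec_self_star (fun _ : X => (1 : ℂ))).smul
    (show (0 : ℝ) ≤ (1 + c) / 2 by linarith)
  have e2 := (Matrix.posSemidef_vecMulVec_self_star
    (fun x : X => if P x then (1 : ℂ) else -1)).smul (show (0 : ℝ) ≤ (1 - c) / 2 by linarith)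
  convert e1.add e2 using 1
  ext x y
  by_cases hx : P x <;> by_cases hy : P y <;> simp [Matrix.vecMulVec, hx, hy] <;> ring

/-- The weight of `σ` in the type B symmetrization. -/
noncomputable def weight {n : ℕ} (α q : ℝ) (σ : Hyperoctahedral n) : ℝ := α ^ l₁ σ * q ^ l₂ σ

lemma weight_inv {n : ℕ} (α q : ℝ) (σ : Hyperoctahedral n) : weight α q σ⁻¹ = weight α q σ := by
  simp [weight, l₁_inv, l₂_inv]

open Classical in
lemma weight_eq {n : ℕ} (α q : ℝ) (σ τ : Hyperoctahedral n) : weight α q (σ⁻¹ * τ) =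
    (∏ k : Fin n, if sep₁ σ τ (k, 1) then α else 1) *
    ∏ p ∈ (Finset.univ : Finset (Fin n × Fin n × ℤˣ)).filter (fun p => p.1 < p.2.1),
      if sep₂ σ τ (p.1, 1) p.2 then q else 1 := by
  have h1 := l₁_inv_mul σ τ
  have h2 := l₂_inv_mul σ τ
  rw [sepCard₁_eq] at h1
  rw [sepCard₂_eq] at h2
  have h1' : l₁ (σ⁻¹ * τ) = ∑ k : Fin n, if sep₁ σ τ (k, 1) then 1 else 0 := by omega
  have h2' : l₂ (σ⁻¹ * τ) = ∑ p : Fin n × Fin n × ℤˣ,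
      if p.1 < p.2.1 ∧ sep₂ σ τ (p.1, 1) p.2 then 1 else 0 := by omega
  rw [weight, h1', h2', ← Finset.prod_pow_eq_pow_sum, ← Finset.prod_pow_eq_pow_sum,
    Finset.prod_filter]
  congr 1
  · refine Finset.prod_congr rfl fun k _ => ?_
    split_ifs <;> simp
  · refine Finset.prod_congr rfl fun k _ => ?_
    by_cases h : k.1 < k.2.1 <;> by_cases h' : sep₂ σ τ (k.1, 1) k.2 <;> simp [h, h']

lemma posSemidef_weight {X : Type*} [Fintype X] {n : ℕ} (s : X → Hyperoctahedral n) (α q : ℝ)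
    (hα : |α| ≤ 1) (hq : |q| ≤ 1) :
    (Matrix.of fun x y => (weight α q ((s x)⁻¹ * s y) : ℂ)).PosSemidef := by
  classical
  have h1 := posSemidef_prod (Finset.univ : Finset (Fin n)) _ fun k _ =>
    posSemidef_ite (fun x : X =>
      ((((s x)⁻¹ : Hyperoctahedral n) : Equiv.Perm (SignedIndex n)) (k, 1)).2 = 1) α hα
  have h2 := posSemidef_prod ((Finset.univ : Finset (Fin n × Fin n × ℤˣ)).filter
    (fun p => p.1 < p.2.1)) _ fun p _ => posSemidef_ite (fun x : X =>
      ((((s x)⁻¹ : Hyperoctahedral n) : Equiv.Perm (SignedIndex n)) (p.1, 1)).val <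
      ((((s x)⁻¹ : Hyperoctahedral n) : Equiv.Perm (SignedIndex n)) p.2).val) q hq
  have h3 := h1.hadamard h2
  refine Eq.mp (congrArg Matrix.PosSemidef ?_) h3
  ext x y
  simp only [Matrix.of_apply, Matrix.hadamard_apply, weight_eq]
  push_cast
  congr 1
  · refine Finset.prod_congr rfl fun k _ => ?_
    have e : ∀ a b : ℤˣ, ¬ (a = 1 ↔ b = 1) ↔ ¬ a = b := by decide
    by_cases h : sep₁ (s x) (s y) (k, 1)
    · rw [if_pos h]
      exact if_pos ((e _ _).2 h)
    · rw [if_neg h, Complex.ofReal_one]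
      exact if_neg fun h' => h ((e _ _).1 h')
  · refine Finset.prod_congr rfl fun p _ => ?_
    by_cases h : sep₂ (s x) (s y) (p.1, 1) p.2
    · rw [if_pos h]
      exact if_pos h
    · rw [if_neg h, Complex.ofReal_one]
      exact if_neg h

/-! ### The complexification of a real Hilbert space -/

/-- The complexification of `E`; the pair `⟨x, y⟩` stands for `x + i y`. -/
@[ext]
structure Complexification (E : Type*) where
  re : E
  im : E

namespace Complexification

variable {E : Type*} [NormedAddCommGroup E] [InnerProductSpace ℝ E]

instance : Zero (Complexification E) := ⟨⟨0, 0⟩⟩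
instance : Add (Complexification E) := ⟨fun z w => ⟨z.re + w.re, z.im + w.im⟩⟩
instance : Neg (Complexification E) := ⟨fun z => ⟨-z.re, -z.im⟩⟩

noncomputable instance : SMul ℂ (Complexification E) :=
  ⟨fun c z => ⟨c.re • z.re - c.im • z.im, c.re • z.im + c.im • z.re⟩⟩

@[simp] lemma zero_re : (0 : Complexification E).re = 0 := rfl
@[simp] lemma zero_im : (0 : Complexification E).im = 0 := rfl
@[simp] lemma add_re (z w : Complexification E) : (z + w).re = z.re + w.re := rfl
@[simp] lemma add_im (z w : Complexification E) : (z + w).im = z.im + w.im := rfl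
@[simp] lemma neg_re (z : Complexification E) : (-z).re = -z.re := rfl
@[simp] lemma neg_im (z : Complexification E) : (-z).im = -z.im := rfl
@[simp] lemma smul_re (c : ℂ) (z : Complexification E) :
    (c • z).re = c.re • z.re - c.im • z.im := rfl
@[simp] lemma smul_im (c : ℂ) (z : Complexification E) :
    (c • z).im = c.re • z.im + c.im • z.re := rfl

instance : AddCommGroup (Complexification E) where
  add_assoc _ _ _ := by ext <;> simp [add_assoc]
  zero_add _ := by ext <;> simp
  add_zero _ := by ext <;> simp
  add_comm _ _ := by ext <;> simp [add_comm]
  neg_add_cancel _ := by ext <;> simp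
  nsmul := nsmulRec
  zsmul := zsmulRec

noncomputable instance : Module ℂ (Complexification E) where
  one_smul _ := by ext <;> simp
  mul_smul _ _ _ := by ext <;> simp <;> module
  smul_zero _ := by ext <;> simp
  smul_add _ _ _ := by ext <;> simp <;> module
  add_smul _ _ _ := by ext <;> simp <;> module
  zero_smul _ := by ext <;> simp

/-- `⟨a + i b, c + i d⟩ = ⟨a, c⟩ + ⟨b, d⟩ + i (⟨a, d⟩ - ⟨b, c⟩)`. -/
@[reducible]
noncomputable def core : InnerProductSpace.Core ℂ (Complexification E) where
  inner z w := ⟨inner ℝ z.re w.re + inner ℝ z.im w.im, inner ℝ z.re w.im - inner ℝ z.im w.re⟩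
  conj_inner_symm z w := by
    apply Complex.ext <;> simp [real_inner_comm]
  re_inner_nonneg z := by
    simpa using add_nonneg (real_inner_self_nonneg (x := z.re)) (real_inner_self_nonneg (x := z.im))
  add_left z w v := by
    apply Complex.ext <;> simp [inner_add_left] <;> ring
  smul_left z w c := by
    apply Complex.ext <;>
      simp [inner_add_left, inner_sub_left, real_inner_smul_left] <;> ring
  definite z h := by
    have h1 := congrArg Complex.re h
    simp only [real_inner_self_eq_norm_sq, Complex.zero_re] at h1
    have h2 : ‖z.re‖ = 0 := by nlinarith [sq_nonneg ‖z.re‖, sq_nonneg ‖z.im‖]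
    have h3 : ‖z.im‖ = 0 := by nlinarith [sq_nonneg ‖z.re‖, sq_nonneg ‖z.im‖]
    ext
    · simpa using h2
    · simpa using h3

noncomputable instance : NormedAddCommGroup (Complexification E) :=
  @InnerProductSpace.Core.toNormedAddCommGroup ℂ _ _ _ _ core

noncomputable instance : InnerProductSpace ℂ (Complexification E) :=
  InnerProductSpace.ofCore core.toCore

/-- The embedding of the real Hilbert space in its complexification. -/
def ofReal (x : E) : Complexification E := ⟨x, 0⟩

lemma inner_def (z w : Complexification E) : inner ℂ z w =
    ⟨inner ℝ z.re w.re + inner ℝ z.im w.im, inner ℝ z.re w.im - inner ℝ z.im w.re⟩ := rfl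

lemma inner_ofReal (x y : E) : inner ℂ (ofReal x) (ofReal y) = ((inner ℝ x y : ℝ) : ℂ) := by
  apply Complex.ext <;> simp [inner_def, ofReal]

end Complexification

/-! ### The `(α, q)`-Fock space -/

section Fock

variable {H : Type*} [NormedAddCommGroup H] [InnerProductSpace ℂ H]

/-- A self-adjoint (complex linear) involution `x ↦ x̄` of `H`. -/
structure SelfAdjointInvolution (H : Type*) [NormedAddCommGroup H] [InnerProductSpace ℂ H] where
  toLinearMap : H →ₗ[ℂ] H
  involutive : Function.Involutive toLinearMap
  symmetric : toLinearMap.IsSymmetric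

/-- `x` or `x̄`, according to the sign. -/
def SelfAdjointInvolution.sign (J : SelfAdjointInvolution H) (s : ℤˣ) : H →ₗ[ℂ] H :=
  if s = 1 then LinearMap.id else J.toLinearMap

lemma SelfAdjointInvolution.inner_sign (J : SelfAdjointInvolution H) (s t : ℤˣ) (x y : H) :
    inner ℂ (J.sign s x) (J.sign t y) = inner ℂ x (J.sign (s * t) y) := by
  have h1 := J.symmetric x
  have h2 := J.involutive
  rcases Int.units_eq_one_or s with rfl | rfl <;>
    rcases Int.units_eq_one_or t with rfl | rfl <;> simp [sign, h1, h2 _]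

lemma SelfAdjointInvolution.sign_sign (J : SelfAdjointInvolution H) (s t : ℤˣ) (x : H) :
    J.sign s (J.sign t x) = J.sign (s * t) x := by
  have h2 := J.involutive
  rcases Int.units_eq_one_or s with rfl | rfl <;>
    rcases Int.units_eq_one_or t with rfl | rfl <;> simp [sign, h2 _]

lemma hyp_apply {n : ℕ} (σ : Hyperoctahedral n) (k : Fin n) (s : ℤˣ) :
    (σ : Equiv.Perm (SignedIndex n)) (k, s) =
      (((σ : Equiv.Perm (SignedIndex n)) (k, 1)).1,
        s * ((σ : Equiv.Perm (SignedIndex n)) (k, 1)).2) := by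
  rcases Int.units_eq_one_or s with rfl | rfl
  · simp
  · have := hyp_opp σ (k, 1)
    simpa [SignedIndex.opp] using this

/-- The permutation `k ↦ |σ k|` of the positions. -/
def absPerm {n : ℕ} (σ : Hyperoctahedral n) : Equiv.Perm (Fin n) where
  toFun k := ((σ : Equiv.Perm (SignedIndex n)) (k, 1)).1
  invFun k := (((σ⁻¹ : Hyperoctahedral n) : Equiv.Perm (SignedIndex n)) (k, 1)).1
  left_inv k := by
    have := (hyp_fst_eq σ⁻¹ (((σ : Equiv.Perm (SignedIndex n)) (k, 1)).1, 1)
      ((σ : Equiv.Perm (SignedIndex n)) (k, 1))).2 rfl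
    refine Eq.trans this ?_
    simp
  right_inv k := by
    have := (hyp_fst_eq σ ((((σ⁻¹ : Hyperoctahedral n) : Equiv.Perm (SignedIndex n)) (k, 1)).1, 1)
      (((σ⁻¹ : Hyperoctahedral n) : Equiv.Perm (SignedIndex n)) (k, 1))).2 rfl
    refine Eq.trans this ?_
    simp

/-- The action of `σ` on a family `x₁, …, x_n`: the vector `x_k` moves to the position `|σ k|`,
and is replaced by `x̄_k` if `σ k` is negative. -/
def actFun (J : SelfAdjointInvolution H) {n : ℕ} (σ : Hyperoctahedral n) (x : Fin n → H) :
    Fin n → H := fun j =>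
  J.sign (((σ⁻¹ : Hyperoctahedral n) : Equiv.Perm (SignedIndex n)) (j, 1)).2
    (x (((σ⁻¹ : Hyperoctahedral n) : Equiv.Perm (SignedIndex n)) (j, 1)).1)

/-- The action of the Coxeter group on `H^{⊗ n}`. -/
noncomputable def act (J : SelfAdjointInvolution H) {n : ℕ} (σ : Hyperoctahedral n) :
    (⨂[ℂ]^n H) →ₗ[ℂ] ⨂[ℂ]^n H :=
  PiTensorProduct.map (fun j : Fin n =>
      J.sign (((σ⁻¹ : Hyperoctahedral n) : Equiv.Perm (SignedIndex n)) (j, 1)).2) ∘ₗ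
    (PiTensorProduct.reindex ℂ (fun _ : Fin n => H) (absPerm σ)).toLinearMap

lemma act_tprod (J : SelfAdjointInvolution H) {n : ℕ} (σ : Hyperoctahedral n) (x : Fin n → H) :
    act J σ (PiTensorProduct.tprod ℂ x) = PiTensorProduct.tprod ℂ (actFun J σ x) := by
  have h1 := PiTensorProduct.reindex_tprod (R := ℂ) (s := fun _ : Fin n => H) (absPerm σ) x
  have h2 := PiTensorProduct.map_tprod (R := ℂ) (fun j : Fin n =>
    J.sign (((σ⁻¹ : Hyperoctahedral n) : Equiv.Perm (SignedIndex n)) (j, 1)).2)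
    (fun j => x ((absPerm σ).symm j))
  exact (congrArg _ h1).trans h2

lemma actFun_one (J : SelfAdjointInvolution H) {n : ℕ} (x : Fin n → H) : actFun J 1 x = x := by
  ext j
  simp [actFun, SelfAdjointInvolution.sign]

lemma actFun_mul (J : SelfAdjointInvolution H) {n : ℕ} (σ τ : Hyperoctahedral n)
    (x : Fin n → H) : actFun J (σ * τ) x = actFun J σ (actFun J τ x) := by
  ext j
  simp only [actFun, J.sign_sign]
  have : ((((σ * τ)⁻¹ : Hyperoctahedral n) : Equiv.Perm (SignedIndex n)) (j, 1)) =
      ((τ⁻¹ : Hyperoctahedral n) : Equiv.Perm (SignedIndex n))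
        (((σ⁻¹ : Hyperoctahedral n) : Equiv.Perm (SignedIndex n)) (j, 1)) := by
    simp [mul_inv_rev]
  rw [this]
  generalize ((σ⁻¹ : Hyperoctahedral n) : Equiv.Perm (SignedIndex n)) (j, 1) = a
  rw [hyp_apply τ⁻¹ a.1 a.2]

/-- `π₀ (x₁ ⊗ ⋯ ⊗ x_n) = x̄₁ ⊗ x₂ ⊗ ⋯ ⊗ x_n`. -/
lemma act_simpleReflection_zero (J : SelfAdjointInvolution H) {n : ℕ} (i : Fin n)
    (hi : (i : ℕ) = 0) (x : Fin n → H) :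
    act J (simpleReflection i) (PiTensorProduct.tprod ℂ x) =
      PiTensorProduct.tprod ℂ (Function.update x i (J.toLinearMap (x i))) := by
  rw [act_tprod]
  congr 1
  ext j
  simp only [actFun, simpleReflection_inv, simpleReflection_zero_apply i hi]
  by_cases h : j = i
  · subst h
    simp [SignedIndex.opp, SelfAdjointInvolution.sign]
  · simp [h, SelfAdjointInvolution.sign]

/-- `π_i (x₁ ⊗ ⋯ ⊗ x_n) = x₁ ⊗ ⋯ ⊗ x_{i+1} ⊗ x_i ⊗ ⋯ ⊗ x_n`. -/
lemma act_simpleReflection_pos (J : SelfAdjointInvolution H) {n : ℕ} (i j : Fin n)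
    (hj : (j : ℕ) + 1 = i) (x : Fin n → H) :
    act J (simpleReflection i) (PiTensorProduct.tprod ℂ x) =
      PiTensorProduct.tprod ℂ (x ∘ Equiv.swap j i) := by
  rw [act_tprod]
  congr 1
  ext k
  have hj' : (⟨(i : ℕ) - 1, by omega⟩ : Fin n) = j := Fin.ext (by simp; omega)
  simp [actFun, simpleReflection_inv, simpleReflection_pos_apply i (show (i : ℕ) ≠ 0 by omega),
    SelfAdjointInvolution.sign, hj']

/-- The functional `y₁ ⊗ ⋯ ⊗ y_n ↦ ∏ ⟨x_i, y_i⟩`. -/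
noncomputable def tensorInnerAux {n : ℕ} (x : Fin n → H) : (⨂[ℂ]^n H) →ₗ[ℂ] ℂ :=
  PiTensorProduct.lift ((MultilinearMap.mkPiAlgebra ℂ (Fin n) ℂ).compLinearMap
    fun i => innerₛₗ ℂ (x i))

lemma tensorInnerAux_tprod {n : ℕ} (x y : Fin n → H) :
    tensorInnerAux x (PiTensorProduct.tprod ℂ y) = ∏ i, inner ℂ (x i) (y i) := by
  simp [tensorInnerAux]

lemma tensor_hom_ext {n : ℕ} {f g : (⨂[ℂ]^n H) →ₗ[ℂ] ℂ}
    (h : ∀ y : Fin n → H, f (PiTensorProduct.tprod ℂ y) = g (PiTensorProduct.tprod ℂ y)) :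
    f = g :=
  PiTensorProduct.ext (MultilinearMap.ext h)

/-- The undeformed inner product on `H^{⊗ n}`:
`⟨x₁ ⊗ ⋯ ⊗ x_n, y₁ ⊗ ⋯ ⊗ y_n⟩ = ∏ ⟨x_i, y_i⟩`. -/
noncomputable def tensorInner (n : ℕ) : (⨂[ℂ]^n H) →+ ((⨂[ℂ]^n H) →ₗ[ℂ] ℂ) :=
  PiTensorProduct.liftAddHom
    (fun p : ℂ × (Fin n → H) => (starRingEnd ℂ) p.1 • tensorInnerAux p.2)
    (by
      intro r f i hf
      rw [show tensorInnerAux f = 0 from tensor_hom_ext fun y => by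
        rw [tensorInnerAux_tprod, Finset.prod_eq_zero (Finset.mem_univ i) (by simp [hf])]
        rfl, smul_zero])
    (by simp)
    (by
      intro _ r f i m₁ m₂
      rw [← smul_add]
      congr 1
      refine tensor_hom_ext fun y => ?_
      have e : ∀ m : H, ∏ j, inner ℂ (Function.update f i m j) (y j) =
          inner ℂ m (y i) * ∏ j ∈ {i}ᶜ, inner ℂ (f j) (y j) := by
        intro m
        rw [Fintype.prod_eq_mul_prod_compl i, Function.update_self]
        congr 1
        refine Finset.prod_congr rfl fun j hj => ?_
        rw [Function.update_of_ne (by simpa using hj)]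
      simp only [LinearMap.add_apply, tensorInnerAux_tprod, e, inner_add_left, add_mul])
    (by
      intro r r' f
      rw [← add_smul, map_add])
    (by
      intro _ r f i r'
      refine tensor_hom_ext fun y => ?_
      simp only [LinearMap.smul_apply, tensorInnerAux_tprod,
        Fintype.prod_eq_mul_prod_compl i, Function.update_self, inner_smul_left]
      rw [Finset.prod_congr rfl (g := fun j => inner ℂ (f j) (y j))]
      · simp only [map_mul, smul_eq_mul]
        ring
      · intro j hj
        rw [Function.update_of_ne (by simpa using hj)])

lemma tensorInner_smul_tprod {n : ℕ} (c : ℂ) (x : Fin n → H) :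
    tensorInner n (c • PiTensorProduct.tprod ℂ x) = (starRingEnd ℂ) c • tensorInnerAux x := by
  rw [← PiTensorProduct.tprodCoeff_eq_smul_tprod]
  rfl

lemma tensorInner_tprod {n : ℕ} (x y : Fin n → H) :
    tensorInner n (PiTensorProduct.tprod ℂ x) (PiTensorProduct.tprod ℂ y) =
      ∏ i, inner ℂ (x i) (y i) := by
  have := tensorInner_smul_tprod (1 : ℂ) x
  rw [one_smul] at this
  simp [this, tensorInnerAux_tprod]

lemma tensorInner_smul {n : ℕ} (c : ℂ) (f : ⨂[ℂ]^n H) :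
    tensorInner n (c • f) = (starRingEnd ℂ) c • tensorInner n f := by
  induction f using PiTensorProduct.induction_on with
  | smul_tprod r x =>
    rw [smul_smul, tensorInner_smul_tprod, tensorInner_smul_tprod, smul_smul, map_mul]
  | add f g hf hg => rw [smul_add, map_add, map_add, hf, hg, smul_add]

noncomputable instance {n : ℕ} : Fintype (Hyperoctahedral n) := Fintype.ofFinite _

/-- The type B symmetrization operator `∑_σ α ^ l₁ σ q ^ l₂ σ σ` on `H^{⊗ n}`. -/
noncomputable def symmetrization (J : SelfAdjointInvolution H) (α q : ℝ) (n : ℕ) :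
    (⨂[ℂ]^n H) →ₗ[ℂ] ⨂[ℂ]^n H :=
  ∑ σ : Hyperoctahedral n, (weight α q σ : ℂ) • act J σ

/-- The deformed inner product on `H^{⊗ n}`. -/
noncomputable def levelInner (J : SelfAdjointInvolution H) (α q : ℝ) (n : ℕ)
    (f g : ⨂[ℂ]^n H) : ℂ :=
  tensorInner n f (symmetrization J α q n g)

lemma prod_inner_actFun (J : SelfAdjointInvolution H) {n : ℕ} (σ τ : Hyperoctahedral n)
    (x y : Fin n → H) : ∏ j, inner ℂ (actFun J σ x j) (actFun J τ y j) =
      ∏ j, inner ℂ (x j) (actFun J (σ⁻¹ * τ) y j) := by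
  rw [← Equiv.prod_comp (absPerm σ)]
  refine Finset.prod_congr rfl fun k _ => ?_
  have h1 : actFun J σ x (absPerm σ k) =
      J.sign ((σ : Equiv.Perm (SignedIndex n)) (k, 1)).2 (x k) := by
    have e := hyp_apply σ⁻¹ ((σ : Equiv.Perm (SignedIndex n)) (k, 1)).1
      ((σ : Equiv.Perm (SignedIndex n)) (k, 1)).2
    simp only [Prod.mk.eta, InvMemClass.coe_inv, Equiv.Perm.inv_def, Equiv.symm_apply_apply] at e
    have e1 := congrArg Prod.fst e
    have e2 := congrArg Prod.snd e
    simp only at e1 e2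
    simp only [actFun, absPerm, Equiv.coe_fn_mk, InvMemClass.coe_inv, Equiv.Perm.inv_def, ← e1]
    congr 2
    rcases Int.units_eq_one_or ((σ : Equiv.Perm (SignedIndex n)) (k, 1)).2 with h | h <;>
    · rw [h] at e2
      rw [h]
      rw [eq_comm] at e2
      first
      | exact (one_mul _).symm.trans e2
      | exact neg_eq_iff_eq_neg.1 ((neg_one_mul _).symm.trans e2)
  rw [h1]
  have h2 : actFun J (σ⁻¹ * τ) y k =
      J.sign ((σ : Equiv.Perm (SignedIndex n)) (k, 1)).2 (actFun J τ y (absPerm σ k)) := by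
    rw [actFun_mul]
    simp [actFun, absPerm]
  rw [h2]
  have := J.inner_sign ((σ : Equiv.Perm (SignedIndex n)) (k, 1)).2 1 (x k)
    (actFun J τ y (absPerm σ k))
  simpa [SelfAdjointInvolution.sign] using this

lemma levelInner_tprod (J : SelfAdjointInvolution H) (α q : ℝ) {n : ℕ} (x y : Fin n → H) :
    levelInner J α q n (PiTensorProduct.tprod ℂ x) (PiTensorProduct.tprod ℂ y) =
      ∑ σ : Hyperoctahedral n, (weight α q σ : ℂ) * ∏ j, inner ℂ (x j) (actFun J σ y j) := by
  simp [levelInner, symmetrization, act_tprod, tensorInner_tprod]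

lemma levelInner_add_left (J : SelfAdjointInvolution H) (α q : ℝ) {n : ℕ} (f g h : ⨂[ℂ]^n H) :
    levelInner J α q n (f + g) h = levelInner J α q n f h + levelInner J α q n g h := by
  simp [levelInner]

lemma levelInner_smul_left (J : SelfAdjointInvolution H) (α q : ℝ) {n : ℕ} (c : ℂ)
    (f g : ⨂[ℂ]^n H) :
    levelInner J α q n (c • f) g = (starRingEnd ℂ) c * levelInner J α q n f g := by
  simp [levelInner, tensorInner_smul]

lemma levelInner_add_right (J : SelfAdjointInvolution H) (α q : ℝ) {n : ℕ} (f g h : ⨂[ℂ]^n H) :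
    levelInner J α q n f (g + h) = levelInner J α q n f g + levelInner J α q n f h := by
  simp [levelInner]

lemma levelInner_smul_right (J : SelfAdjointInvolution H) (α q : ℝ) {n : ℕ} (c : ℂ)
    (f g : ⨂[ℂ]^n H) :
    levelInner J α q n f (c • g) = c * levelInner J α q n f g := by
  simp [levelInner]

lemma levelInner_conj (J : SelfAdjointInvolution H) (α q : ℝ) {n : ℕ} (f g : ⨂[ℂ]^n H) :
    (starRingEnd ℂ) (levelInner J α q n g f) = levelInner J α q n f g := by
  induction f using PiTensorProduct.induction_on with
  | add f f' hf hf' => rw [levelInner_add_left, levelInner_add_right, map_add, hf, hf']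
  | smul_tprod r x =>
  induction g using PiTensorProduct.induction_on with
  | add f f' hf hf' => rw [levelInner_add_left, levelInner_add_right, map_add, hf, hf']
  | smul_tprod s y =>
  simp only [levelInner_smul_left, levelInner_smul_right, map_mul, levelInner_tprod, map_sum,
    map_prod, inner_conj_symm, Complex.conj_conj, Complex.conj_ofReal]
  have : ∀ σ : Hyperoctahedral n, (weight α q σ : ℂ) * ∏ j, inner ℂ (actFun J σ x j) (y j) =
      (weight α q σ⁻¹ : ℂ) * ∏ j, inner ℂ (x j) (actFun J σ⁻¹ y j) := by
    intro σ
    have h := prod_inner_actFun J σ 1 x y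
    rw [actFun_one, mul_one] at h
    rw [h, weight_inv]
  rw [Finset.sum_congr rfl fun σ _ => this σ]
  have h2 := Equiv.sum_comp (Equiv.inv (Hyperoctahedral n))
    (fun σ => (weight α q σ : ℂ) * ∏ j, inner ℂ (x j) (actFun J σ y j))
  simp only [Equiv.inv_apply] at h2
  rw [h2]
  ring

lemma levelInner_self_nonneg (J : SelfAdjointInvolution H) {α q : ℝ} (hα : |α| ≤ 1)
    (hq : |q| ≤ 1) {n : ℕ} (f : ⨂[ℂ]^n H) : 0 ≤ (levelInner J α q n f f).re := by
  classical
  have hf : f ∈ Submodule.span ℂ (Set.range (PiTensorProduct.tprod ℂ : _ → ⨂[ℂ]^n H)) := by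
    rw [PiTensorProduct.span_tprod_eq_top]; trivial
  obtain ⟨m, c, g, hg⟩ := Submodule.mem_span_set'.1 hf
  choose x hx using fun i => (g i).2
  have hfx : f = ∑ i, c i • PiTensorProduct.tprod ℂ (x i) := by
    rw [← hg]
    exact Finset.sum_congr rfl fun i _ => by rw [hx]
  have hsl : ∀ (h : ⨂[ℂ]^n H), levelInner J α q n f h = ∑ i, (starRingEnd ℂ) (c i) *
      levelInner J α q n (PiTensorProduct.tprod ℂ (x i)) h := by
    intro h
    simp [hfx, levelInner, tensorInner_smul]
  have hsr : ∀ (h : ⨂[ℂ]^n H), levelInner J α q n h f = ∑ i, c i *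
      levelInner J α q n h (PiTensorProduct.tprod ℂ (x i)) := by
    intro h
    simp [hfx, levelInner]
  let X := Fin m × Hyperoctahedral n
  have hM := (posSemidef_weight (fun p : X => p.2) α q hα hq).hadamard
    (posSemidef_prod (Finset.univ : Finset (Fin n)) _ fun j _ =>
      Matrix.posSemidef_gram ℂ (fun p : X => actFun J p.2 (x p.1) j))
  have h0 := hM.dotProduct_mulVec_nonneg (fun p : X => c p.1)
  have key : dotProduct (star fun p : X => c p.1) (Matrix.mulVec ((Matrix.of fun p r : X =>
      (weight α q (p.2⁻¹ * r.2) : ℂ)).hadamard (Matrix.of fun p r : X => ∏ j,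
        Matrix.gram ℂ (fun p : X => actFun J p.2 (x p.1) j) p r)) fun p : X => c p.1) =
      (Fintype.card (Hyperoctahedral n) : ℂ) * levelInner J α q n f f := by
    rw [hsl]
    simp only [hsr, dotProduct, Matrix.mulVec, Matrix.hadamard_apply, Matrix.of_apply,
      Matrix.gram, Pi.star_apply, levelInner_tprod, X, Fintype.sum_prod_type]
    simp only [prod_inner_actFun]
    rw [Finset.mul_sum]
    refine Finset.sum_congr rfl fun i _ => ?_
    have : ∀ σ : Hyperoctahedral n, (star (c i) * ∑ k, ∑ τ : Hyperoctahedral n,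
        (weight α q (σ⁻¹ * τ) : ℂ) * (∏ j, inner ℂ (x i j) (actFun J (σ⁻¹ * τ) (x k) j)) * c k) =
        (starRingEnd ℂ) (c i) * ∑ k, c k * ∑ τ : Hyperoctahedral n, (weight α q τ : ℂ) *
          ∏ j, inner ℂ (x i j) (actFun J τ (x k) j) := by
      intro σ
      congr 1
      refine Finset.sum_congr rfl fun k _ => ?_
      rw [Finset.mul_sum]
      rw [← Equiv.sum_comp (Equiv.mulLeft σ⁻¹) (fun τ => c k * ((weight α q τ : ℂ) *
          ∏ j, inner ℂ (x i j) (actFun J τ (x k) j)))]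
      refine Finset.sum_congr rfl fun τ _ => ?_
      simp only [Equiv.coe_mulLeft]
      ring
    rw [Finset.sum_congr rfl fun σ _ => this σ]
    simp
  have h1 : 0 ≤ (Fintype.card (Hyperoctahedral n) : ℂ) * levelInner J α q n f f := by
    rw [← key]
    exact h0
  have h2 := (Complex.le_def.1 h1).1
  rw [Complex.zero_re, ← Complex.ofReal_natCast, Complex.re_ofReal_mul] at h2
  have h3 : (0 : ℝ) < Fintype.card (Hyperoctahedral n) := by exact_mod_cast Fintype.card_pos
  exact nonneg_of_mul_nonneg_right h2 h3

/-- The algebraic full Fock space `⨁ H^{⊗ n}`, to be equipped with the deformed inner product. -/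
def FockSpace (_J : SelfAdjointInvolution H) {α q : ℝ} (_hα : α ∈ Set.Ioo (-1 : ℝ) 1)
    (_hq : q ∈ Set.Ioo (-1 : ℝ) 1) : Type _ :=
  DirectSum ℕ fun n => ⨂[ℂ]^n H

namespace FockSpace

variable (J : SelfAdjointInvolution H) {α q : ℝ} (hα : α ∈ Set.Ioo (-1 : ℝ) 1)
  (hq : q ∈ Set.Ioo (-1 : ℝ) 1)

noncomputable instance : AddCommGroup (FockSpace J hα hq) :=
  inferInstanceAs (AddCommGroup (DirectSum ℕ fun n => ⨂[ℂ]^n H))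

noncomputable instance : Module ℂ (FockSpace J hα hq) :=
  inferInstanceAs (Module ℂ (DirectSum ℕ fun n => ⨂[ℂ]^n H))

variable {J hα hq} in
/-- The component of `f` in `H^{⊗ n}`. -/
def component (f : FockSpace J hα hq) (n : ℕ) : ⨂[ℂ]^n H := DFinsupp.toFun f n

/-- The inclusion of `H^{⊗ n}` in the Fock space. -/
noncomputable def incl (n : ℕ) : (⨂[ℂ]^n H) →ₗ[ℂ] FockSpace J hα hq :=
  DirectSum.lof ℂ ℕ (fun n => ⨂[ℂ]^n H) n

variable {J hα hq} in
/-- The deformed inner product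
`⟨f, g⟩_{α,q} = ∑_n ⟨f_n, P_n g_n⟩`, where all but finitely many summands are zero. -/
noncomputable def deformedInner (f g : FockSpace J hα hq) : ℂ :=
  ∑ᶠ n, levelInner J α q n (f.component n) (g.component n)

variable {J hα hq} in
lemma component_add (f g : FockSpace J hα hq) (n : ℕ) :
    (f + g).component n = f.component n + g.component n := rfl

variable {J hα hq} in
lemma component_smul (c : ℂ) (f : FockSpace J hα hq) (n : ℕ) :
    (c • f).component n = c • f.component n := rfl

variable {J hα hq} in
lemma finite_support (f g : FockSpace J hα hq) :
    (Function.support fun n => levelInner J α q n (f.component n) (g.component n)).Finite := by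
  classical
  refine (DFinsupp.finite_support f).subset fun n hn => ?_
  simp only [Function.mem_support, Set.mem_ofPred_eq] at hn ⊢
  intro h
  apply hn
  have : f.component n = 0 := h
  simp [this, levelInner]

/-- The deformed form is a (semi-)inner product. -/
@[reducible]
noncomputable def core : PreInnerProductSpace.Core ℂ (FockSpace J hα hq) where
  inner := deformedInner
  conj_inner_symm f g := by
    simp only [deformedInner]
    refine (AddMonoidHom.map_finsum (starRingEnd ℂ : ℂ →+* ℂ).toAddMonoidHom
      (finite_support g f)).trans ?_
    exact finsum_congr fun n => levelInner_conj J α q _ _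
  re_inner_nonneg f := by
    simp only [deformedInner]
    have h := AddMonoidHom.map_finsum Complex.reAddGroupHom (finite_support f f)
    refine le_of_le_of_eq ?_ h.symm
    exact finsum_nonneg fun n => levelInner_self_nonneg J
      (abs_le.2 ⟨hα.1.le, hα.2.le⟩) (abs_le.2 ⟨hq.1.le, hq.2.le⟩) _
  add_left f g h := by
    simp only [deformedInner, component_add, levelInner_add_left]
    exact finsum_add_distrib (finite_support f h) (finite_support g h)
  smul_left f g c := by
    simp only [deformedInner, component_smul, levelInner_smul_left]
    exact (mul_finsum _ _).symm

noncomputable instance : SeminormedAddCommGroup (FockSpace J hα hq) :=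
  @InnerProductSpace.Core.toSeminormedAddCommGroup ℂ _ _ _ _ (core J hα hq)

noncomputable instance : InnerProductSpace ℂ (FockSpace J hα hq) :=
  InnerProductSpace.ofCore (core J hα hq)

lemma inner_def (f g : FockSpace J hα hq) : inner ℂ f g = deformedInner f g := rfl

/-- The vacuum vector `Ω`, spanning `H^{⊗ 0} = ℂ Ω`. -/
noncomputable def vacuum : FockSpace J hα hq :=
  incl J hα hq 0 (PiTensorProduct.tprod ℂ Fin.elim0)

/-- The right creation operator `x₁ ⊗ ⋯ ⊗ x_n ↦ x₁ ⊗ ⋯ ⊗ x_n ⊗ x` on the algebraic Fock space. -/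
noncomputable def creation (x : H) : FockSpace J hα hq →ₗ[ℂ] FockSpace J hα hq :=
  DirectSum.toModule ℂ ℕ _ fun n => incl J hα hq (n + 1) ∘ₗ
    ((TensorPower.mulEquiv (R := ℂ) (M := H) (n := n) (m := 1)).toLinearMap ∘ₗ
      (TensorProduct.mk ℂ (⨂[ℂ]^n H) (⨂[ℂ]^1 H)).flip (PiTensorProduct.tprod ℂ fun _ => x))

lemma creation_tprod (x : H) {n : ℕ} (v : Fin n → H) :
    creation J hα hq x (incl J hα hq n (PiTensorProduct.tprod ℂ v)) =
      incl J hα hq (n + 1) (PiTensorProduct.tprod ℂ (Fin.snoc v x : Fin (n + 1) → H)) := by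
  refine (DirectSum.toModule_lof ℂ n _).trans ?_
  have h := TensorPower.tprod_mul_tprod ℂ v (fun _ : Fin 1 => x)
  rw [TensorPower.gMul_def] at h
  rw [← Fin.append_right_eq_snoc v (fun _ : Fin 1 => x)]
  exact congrArg (incl J hα hq (n + 1)) h

/-- The completion of the Fock space. -/
abbrev Completed : Type _ := UniformSpace.Completion (FockSpace J hα hq)

/-- `C` is the bounded extension of the creation operator to the completion. -/
def IsCreation (x : H) (C : Completed J hα hq →L[ℂ] Completed J hα hq) : Prop :=
  ∀ f : FockSpace J hα hq, C f = (creation J hα hq x f : FockSpace J hα hq)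

/-- `G` is the Gaussian operator: the sum of the creation operator and
its adjoint, the annihilation operator. -/
def IsGaussian (x : H) (G : Completed J hα hq →L[ℂ] Completed J hα hq) : Prop :=
  ∃ C, IsCreation J hα hq x C ∧ G = ContinuousLinearMap.adjoint C + C

/-- The vacuum state. -/
noncomputable def vacuumState (T : Completed J hα hq →L[ℂ] Completed J hα hq) : ℂ :=
  inner ℂ (vacuum J hα hq : Completed J hα hq) (T (vacuum J hα hq : Completed J hα hq))

end FockSpace

end Fock

/-! ### von Neumann algebras and traces -/

/-- The von Neumann algebra generated by a set of bounded operators: the double commutant of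
the set together with its adjoints. -/
noncomputable def generatedVonNeumannAlgebra {K : Type*} [NormedAddCommGroup K]
    [InnerProductSpace ℂ K] [CompleteSpace K] (S : Set (K →L[ℂ] K)) : VonNeumannAlgebra K where
  toStarSubalgebra := StarSubalgebra.centralizer ℂ (StarSubalgebra.centralizer ℂ S : Set _)
  centralizer_centralizer' := by
    change Set.centralizer (Set.centralizer ((StarSubalgebra.centralizer ℂ
      (StarSubalgebra.centralizer ℂ S : Set (K →L[ℂ] K)) : StarSubalgebra ℂ (K →L[ℂ] K)) :
        Set (K →L[ℂ] K))) = _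
    rw [StarSubalgebra.coe_centralizer_centralizer ℂ S,
      Set.centralizer_centralizer_centralizer]
    exact (StarSubalgebra.coe_centralizer_centralizer ℂ S).symm

/-- A functional `φ` is a trace on the von Neumann algebra `A`. -/
def IsTraceOn {K : Type*} [NormedAddCommGroup K] [InnerProductSpace ℂ K] [CompleteSpace K]
    (A : VonNeumannAlgebra K) (φ : (K →L[ℂ] K) → ℂ) : Prop :=
  ∀ S ∈ A, ∀ T ∈ A, φ (S * T) = φ (T * S)

end TypeB

/-!
The annihilation operator `B(u)` takes the tensor factors out one at a time, weighting the removal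
of the `k`-th of `n` factors by `⟨u, ·⟩` times a power of `q` that decays geometrically in the
distance from either end. Hence every power `(B(u) B*(u))ᵐ` of the symmetric operator
`B(u) B*(u)` is bounded by `Cᵐ` times a constant on each algebraic vector, with `C` independent
of the vector. Since a symmetric operator satisfies `‖T f‖ ^ 2ᵐ ≤ ‖f‖ ^ (2ᵐ - 1) * ‖T ^ 2ᵐ f‖`,
this forces `‖B(u) B*(u)‖ ≤ C`, whence `B*(u)` is bounded.

If `α ≠ 0` and the vacuum state is a trace, its two-point function shows that `⟨x, J y⟩` is
symmetric for real `x` and `y`, and the cyclic invariance of its four-point function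
`⟨G(x) G(y) G(z) G(w)⟩` then yields
`⟨x, y⟩_{α,q} ⟨z, J w⟩ = ⟨x, w⟩_{α,q} ⟨y, J z⟩`. In dimension at least two, some nonzero real `w`
satisfies `⟨x, J w⟩ = 0` for a given `x ≠ 0`, and then `J w = 0`, which is absurd for an involution.

If `α = 0`, reversing the order of the tensor factors is unitary and turns `G(x)` into a left
Gaussian operator, which commutes with all right ones and has the same effect on the vacuum. The
products of the `G(x)` thus have partners in the commutant which act identically on the vacuum.
As the vacuum is cyclic, this makes the vacuum state a trace.
-/

namespace TypeB

section SignedPermutations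

variable {n : ℕ}

/-- A signed permutation written as a permutation `π` together with a vector `s` of signs; the
pair `(π, s)` encodes `(k, t) ↦ (π k, t * s k)`. -/
def signedPermEquiv : Equiv.Perm (Fin n) × (Fin n → ℤˣ) ≃ Hyperoctahedral n where
  toFun p :=
    ⟨{ toFun := fun a => (p.1 a.1, a.2 * p.2 a.1)
       invFun := fun a => (p.1.symm a.1, a.2 * p.2 (p.1.symm a.1))
       left_inv := fun a => by simp [mul_assoc]
       right_inv := fun a => by simp [mul_assoc] },
     fun a => by simp [SignedIndex.opp]⟩
  invFun σ := (absPerm σ, fun k => ((σ : Equiv.Perm (SignedIndex n)) (k, 1)).2)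
  left_inv p := Prod.ext (Equiv.ext fun _ => rfl) (funext fun _ => one_mul _)
  right_inv σ := Subtype.ext <| Equiv.ext fun a => (hyp_apply σ a.1 a.2).symm

lemma signedPermEquiv_apply (p : Equiv.Perm (Fin n) × (Fin n → ℤˣ)) (k : Fin n) (t : ℤˣ) :
    (signedPermEquiv p : Equiv.Perm (SignedIndex n)) (k, t) = (p.1 k, t * p.2 k) := rfl

/-- The factor which the values `a = σ i` and `b = σ j`, for `i < j`, contribute to the `q`-part
of the weight of a signed permutation `σ`: one `q` if they are inverted, and one more if their sum
is negative. -/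
noncomputable def pairWeight (q : ℝ) (a b : SignedIndex n) : ℝ :=
  (if b.val < a.val then q else 1) * if a.val + b.val < 0 then q else 1

open Classical in
lemma prod_sep₁_signedPermEquiv (α : ℝ) (π : Equiv.Perm (Fin n)) (s : Fin n → ℤˣ) :
    ∏ k, (if sep₁ (signedPermEquiv (π, s))⁻¹ 1 (k, 1) then α else 1) =
      ∏ k, if s k = 1 then 1 else α := by
  refine Finset.prod_congr rfl fun k _ => ?_
  simp only [sep₁, inv_inv, signedPermEquiv_apply, one_mul, inv_one, Subgroup.coe_one,
    Equiv.Perm.one_apply, ite_not]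

lemma not_val_one_lt_val_neg_one {i j : Fin n} :
    ¬ SignedIndex.val (i, 1) < SignedIndex.val (j, -1) := by
  simp only [SignedIndex.val, Units.val_one, Units.val_neg]
  omega

open Classical in
lemma prod_sep₂_signedPermEquiv (q : ℝ) (π : Equiv.Perm (Fin n)) (s : Fin n → ℤˣ) {i j : Fin n}
    (hij : i < j) :
    ∏ t : ℤˣ, (if sep₂ (signedPermEquiv (π, s))⁻¹ 1 (i, 1) (j, t) then q else 1) =
      pairWeight q (π i, s i) (π j, s j) := by
  have val_ne (t : ℤˣ) : SignedIndex.val (π i, s i) ≠ SignedIndex.val (π j, t) := fun h =>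
    hij.ne (π.injective (congrArg Prod.fst (SignedIndex.val_injective h)))
  have val_neg : SignedIndex.val (π j, -s j) = -SignedIndex.val (π j, s j) :=
    SignedIndex.val_opp (π j, s j)
  have hne := val_ne (s j)
  have hne' := val_ne (-s j)
  have hlt : SignedIndex.val (i, 1) < SignedIndex.val (j, 1) := by
    simpa [SignedIndex.val] using hij
  rw [UnitsInt.univ, Finset.prod_pair (by decide)]
  simp only [sep₂, inv_inv, signedPermEquiv_apply, one_mul, inv_one, Subgroup.coe_one,
    Equiv.Perm.one_apply, hlt, not_val_one_lt_val_neg_one, iff_true, iff_false, not_not, neg_mul,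
    pairWeight]
  rw [val_neg] at hne' ⊢
  congr 1 <;> exact if_congr (by omega) rfl rfl

lemma weight_signedPermEquiv (α q : ℝ) (π : Equiv.Perm (Fin n)) (s : Fin n → ℤˣ) :
    weight α q (signedPermEquiv (π, s)) = (∏ k, if s k = 1 then 1 else α) *
      ∏ j, ∏ i, if i < j then pairWeight q (π i, s i) (π j, s j) else 1 := by
  classical
  have h := weight_eq α q (signedPermEquiv (π, s))⁻¹ 1
  rw [inv_inv, mul_one] at h
  rw [h, prod_sep₁_signedPermEquiv, Finset.prod_filter, Fintype.prod_prod_type]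
  simp only [Fintype.prod_prod_type]
  rw [Finset.prod_comm]
  congr 1
  refine Finset.prod_congr rfl fun j _ => Finset.prod_congr rfl fun i _ => ?_
  by_cases hij : i < j
  · simpa only [hij, if_true] using prod_sep₂_signedPermEquiv q π s hij
  · simp only [hij, if_false, Finset.prod_const_one]

/-- The permutation of `Fin (n + 1)` with last value `k` whose other values are in the same
relative order as those of `π`. -/
def extendPerm (k : Fin (n + 1)) (π : Equiv.Perm (Fin n)) : Equiv.Perm (Fin (n + 1)) :=
  (finSuccEquivLast.trans (Equiv.optionCongr π)).trans (finSuccEquiv' k).symm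

@[simp] lemma extendPerm_last (k : Fin (n + 1)) (π : Equiv.Perm (Fin n)) :
    extendPerm k π (Fin.last n) = k := by simp [extendPerm]

@[simp] lemma extendPerm_castSucc (k : Fin (n + 1)) (π : Equiv.Perm (Fin n)) (i : Fin n) :
    extendPerm k π i.castSucc = k.succAbove (π i) := by simp [extendPerm]

lemma extendPerm_bijective :
    Function.Bijective fun p : Fin (n + 1) × Equiv.Perm (Fin n) => extendPerm p.1 p.2 := by
  rw [Fintype.bijective_iff_injective_and_card]
  constructor
  · rintro ⟨k, π⟩ ⟨l, ρ⟩ h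
    have hval (i : Fin (n + 1)) : extendPerm k π i = extendPerm l ρ i := congrArg (· i) h
    obtain rfl : k = l := by simpa using hval (Fin.last n)
    refine Prod.ext rfl (Equiv.ext fun i => ?_)
    simpa using hval i.castSucc
  · simp [Fintype.card_perm, Nat.factorial_succ]

lemma pairWeight_succAbove (q : ℝ) (k : Fin (n + 1)) (a b : Fin n) (s t : ℤˣ) :
    pairWeight q (k.succAbove a, s) (k.succAbove b, t) = pairWeight q (a, s) (b, t) := by
  have hlt : k.succAbove a < k.succAbove b ↔ a < b := k.strictMono_succAbove.lt_iff_lt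
  have hgt : k.succAbove b < k.succAbove a ↔ b < a := k.strictMono_succAbove.lt_iff_lt
  rw [Fin.lt_def, Fin.lt_def] at hlt hgt
  simp only [pairWeight, SignedIndex.val]
  rcases Int.units_eq_one_or s with rfl | rfl <;> rcases Int.units_eq_one_or t with rfl | rfl <;>
    simp only [Units.val_one, Units.val_neg] <;> congr 1 <;> exact if_congr (by omega) rfl rfl

lemma pairWeight_succAbove_self (q : ℝ) (k : Fin (n + 1)) (a : Fin n) (s t : ℤˣ) :
    pairWeight q (k.succAbove a, s) (k, t) =
      if t = 1 then (if (k : ℕ) ≤ a then q else 1) else q * if (a : ℕ) < k then q else 1 := by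
  have hval : (k.succAbove a : ℕ) = if (a : ℕ) < k then (a : ℕ) else a + 1 := by
    simp only [Fin.succAbove, Fin.lt_def, Fin.val_castSucc]
    split_ifs <;> simp
  have hsign : (-1 : ℤˣ) ≠ 1 := by decide
  simp only [pairWeight, SignedIndex.val, hval]
  rcases Int.units_eq_one_or s with rfl | rfl <;> rcases Int.units_eq_one_or t with rfl | rfl <;>
    simp only [Units.val_one, Units.val_neg, one_mul, neg_mul, if_true, hsign, if_false] <;>
    split_ifs <;> first | omega | simp

lemma prod_ite_val_lt (q : ℝ) (k : Fin (n + 1)) :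
    ∏ a : Fin n, (if (a : ℕ) < k then q else 1) = q ^ (k : ℕ) := by
  rw [Finset.prod_ite, Finset.prod_const_one, mul_one, Finset.prod_const,
    Fin.card_filter_val_lt, min_eq_right k.is_le]

lemma prod_ite_le_val (q : ℝ) (k : Fin (n + 1)) :
    ∏ a : Fin n, (if (k : ℕ) ≤ a then q else 1) = q ^ (k.rev : ℕ) := by
  rw [← prod_ite_val_lt, ← Equiv.prod_comp Fin.revPerm]
  refine Finset.prod_congr rfl fun a _ => if_congr ?_ rfl rfl
  simp only [Fin.revPerm_apply, Fin.val_rev]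
  omega

lemma weight_extendPerm (α q : ℝ) (k : Fin (n + 1)) (t : ℤˣ) (π : Equiv.Perm (Fin n))
    (s : Fin n → ℤˣ) :
    weight α q (signedPermEquiv (extendPerm k π, (Fin.snoc s t : Fin (n + 1) → ℤˣ))) =
      (if t = 1 then q ^ (k.rev : ℕ) else α * q ^ (n + k : ℕ)) *
        weight α q (signedPermEquiv (π, s)) := by
  simp only [weight_signedPermEquiv, Fin.prod_univ_castSucc, Fin.snoc_castSucc, Fin.snoc_last,
    extendPerm_castSucc, extendPerm_last, Fin.castSucc_lt_castSucc_iff, Fin.castSucc_lt_last,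
    if_true, pairWeight_succAbove, lt_irrefl, if_false, mul_one, pairWeight_succAbove_self,
    (Fin.castSucc_lt_last _).not_gt]
  rw [Equiv.prod_comp π (fun a : Fin n => if t = 1 then (if (k : ℕ) ≤ a then q else 1)
    else q * if (a : ℕ) < k then q else 1)]
  by_cases ht : t = 1
  · simp only [ht, if_true, prod_ite_le_val]
    ring
  · simp only [ht, if_false, Finset.prod_mul_distrib, Finset.prod_const, Finset.card_univ,
      Fintype.card_fin, prod_ite_val_lt]
    ring

end SignedPermutations

section AlgebraicFockSpace

variable {H : Type*} [NormedAddCommGroup H] [InnerProductSpace ℂ H]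

lemma levelInner_eq_sum_signedPerm (J : SelfAdjointInvolution H) (α q : ℝ) {n : ℕ}
    (x y : Fin n → H) :
    levelInner J α q n (PiTensorProduct.tprod ℂ x) (PiTensorProduct.tprod ℂ y) =
      ∑ π : Equiv.Perm (Fin n), ∑ s : Fin n → ℤˣ, (weight α q (signedPermEquiv (π, s)) : ℂ) *
        ∏ j, inner ℂ (x j) (J.sign (s j) (y (π j))) := by
  rw [levelInner_tprod, ← Fintype.sum_prod_type' (f := fun π s =>
    (weight α q (signedPermEquiv (π, s)) : ℂ) * ∏ j, inner ℂ (x j) (J.sign (s j) (y (π j)))),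
    ← Equiv.sum_comp (Equiv.inv (Hyperoctahedral n)), ← signedPermEquiv.sum_comp]
  refine Finset.sum_congr rfl fun p _ => ?_
  simp [weight_inv, actFun, signedPermEquiv_apply]

/-- The functional `y ↦ ⟨u, Θ y⟩` weighting the removal of the `k`-th of `n + 1` factors `y` by the
annihilation operator of `u`, where `Θ = q ^ (n - k) + α q ^ (n + k) J` sums the weights of moving
that factor to the last place, either directly or through the first place. -/
noncomputable def removalFunctional (J : SelfAdjointInvolution H) (α q : ℝ) (u : H) {n : ℕ}
    (k : Fin (n + 1)) : H →ₗ[ℂ] ℂ :=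
  (q ^ (k.rev : ℕ) : ℂ) • innerₛₗ ℂ u + (α * q ^ (n + k : ℕ) : ℂ) • innerₛₗ ℂ u ∘ₗ J.toLinearMap

lemma removalFunctional_apply (J : SelfAdjointInvolution H) (α q : ℝ) (u : H) {n : ℕ}
    (k : Fin (n + 1)) (y : H) :
    removalFunctional J α q u k y =
      q ^ (k.rev : ℕ) * inner ℂ u y + α * q ^ (n + k : ℕ) * inner ℂ u (J.toLinearMap y) := rfl

lemma removalFunctional_eq_sum_sign (J : SelfAdjointInvolution H) (α q : ℝ) (u : H) {n : ℕ}
    (k : Fin (n + 1)) (y : H) :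
    removalFunctional J α q u k y =
      ∑ t : ℤˣ, ((if t = 1 then q ^ (k.rev : ℕ) else α * q ^ (n + k : ℕ) : ℝ) : ℂ) *
        inner ℂ u (J.sign t y) := by
  have hsign : (-1 : ℤˣ) ≠ 1 := by decide
  rw [UnitsInt.univ, Finset.sum_pair hsign.symm]
  simp [removalFunctional_apply, hsign, SelfAdjointInvolution.sign]

lemma levelInner_snoc (J : SelfAdjointInvolution H) (α q : ℝ) {n : ℕ}
    (x : Fin n → H) (u : H) (y : Fin (n + 1) → H) :
    levelInner J α q (n + 1) (PiTensorProduct.tprod ℂ (Fin.snoc x u : Fin (n + 1) → H))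
        (PiTensorProduct.tprod ℂ y) =
      ∑ k, removalFunctional J α q u k (y k) *
        levelInner J α q n (PiTensorProduct.tprod ℂ x)
          (PiTensorProduct.tprod ℂ (k.removeNth y)) := by
  rw [levelInner_eq_sum_signedPerm, ← (Equiv.ofBijective _ extendPerm_bijective).sum_comp,
    Fintype.sum_prod_type]
  refine Finset.sum_congr rfl fun k _ => ?_
  rw [levelInner_eq_sum_signedPerm, Finset.mul_sum]
  refine Finset.sum_congr rfl fun π _ => ?_
  rw [← (Fin.snocEquiv fun _ : Fin (n + 1) => ℤˣ).sum_comp, Fintype.sum_prod_type,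
    removalFunctional_eq_sum_sign, Finset.sum_mul]
  refine Finset.sum_congr rfl fun t _ => ?_
  rw [Finset.mul_sum]
  refine Finset.sum_congr rfl fun s _ => ?_
  rw [show (Fin.snocEquiv fun _ : Fin (n + 1) => ℤˣ) (t, s) = Fin.snoc s t from rfl]
  simp only [Equiv.ofBijective_apply, Fin.prod_univ_castSucc, Fin.snoc_castSucc, Fin.snoc_last,
    extendPerm_castSucc, extendPerm_last, weight_extendPerm, Fin.removeNth_apply,
    Complex.ofReal_mul]
  ring

namespace FockSpace

variable (J : SelfAdjointInvolution H) {α q : ℝ} (hα : α ∈ Set.Ioo (-1 : ℝ) 1)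
  (hq : q ∈ Set.Ioo (-1 : ℝ) 1)

/-- The simple tensor `x₁ ⊗ ⋯ ⊗ xₙ` as an element of the algebraic Fock space. -/
noncomputable def pure {n : ℕ} (x : Fin n → H) : FockSpace J hα hq :=
  incl J hα hq n (PiTensorProduct.tprod ℂ x)

/-- The annihilation operator of `u` on the algebraic Fock space, adjoint to `creation u`. -/
noncomputable def annihilation (u : H) : FockSpace J hα hq →ₗ[ℂ] FockSpace J hα hq :=
  DirectSum.toModule ℂ ℕ _ fun
    | 0 => 0
    | n + 1 => incl J hα hq n ∘ₗ PiTensorProduct.lift (∑ k,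
        ((removalFunctional J α q u k).smulRight
          (PiTensorProduct.tprod ℂ : MultilinearMap ℂ (fun _ : Fin n => H) _)).uncurryMid k)

variable {J hα hq}

@[elab_as_elim]
lemma induction_pure {p : FockSpace J hα hq → Prop} (f : FockSpace J hα hq)
    (pure : ∀ (n : ℕ) (x : Fin n → H), p (pure J hα hq x))
    (smul : ∀ (c : ℂ) f, p f → p (c • f)) (add : ∀ f g, p f → p g → p (f + g)) : p f := by
  induction f using DirectSum.induction_on with
  | zero =>
    have h := smul 0 _ (pure 0 Fin.elim0)
    rwa [zero_smul] at h
  | of n f =>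
    change p (incl J hα hq n f)
    induction f using PiTensorProduct.induction_on with
    | smul_tprod r x =>
      rw [map_smul]
      exact smul _ _ (pure n x)
    | add f g hf hg =>
      rw [map_add]
      exact add _ _ hf hg
  | add f g hf hg => exact add _ _ hf hg

lemma hom_ext {V : Type*} [AddCommGroup V] [Module ℂ V] {A B : FockSpace J hα hq →ₗ[ℂ] V}
    (h : ∀ (n : ℕ) (x : Fin n → H), A (pure J hα hq x) = B (pure J hα hq x)) : A = B := by
  ext f
  induction f using induction_pure with
  | pure n x => exact h n x
  | smul c f hf => rw [map_smul, map_smul, hf]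
  | add f g hf hg => rw [map_add, map_add, hf, hg]

lemma component_incl (n m : ℕ) (f : ⨂[ℂ]^n H) :
    (incl J hα hq n f).component m = if h : n = m then h ▸ f else 0 := by
  by_cases h : n = m
  · subst h
    exact (dif_pos rfl).symm ▸ DirectSum.of_eq_same (β := fun n => ⨂[ℂ]^n H) n f
  · rw [dif_neg h]
    exact DirectSum.of_eq_of_ne (β := fun n => ⨂[ℂ]^n H) n m f (Ne.symm h)

lemma inner_pure {n : ℕ} (x y : Fin n → H) : inner ℂ (pure J hα hq x) (pure J hα hq y) =
    levelInner J α q n (PiTensorProduct.tprod ℂ x) (PiTensorProduct.tprod ℂ y) := by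
  rw [inner_def, deformedInner, finsum_eq_single _ n]
  · simp [pure, component_incl]
  · intro m hm
    simp [pure, component_incl, hm.symm, levelInner]

lemma inner_pure_of_ne {m n : ℕ} (hmn : m ≠ n) (x : Fin m → H) (y : Fin n → H) :
    inner ℂ (pure J hα hq x) (pure J hα hq y) = 0 := by
  rw [inner_def, deformedInner]
  refine finsum_eq_zero_of_forall_eq_zero fun k => ?_
  by_cases h : m = k
  · have hnk : n ≠ k := fun hnk => hmn (h.trans hnk.symm)
    simp [pure, component_incl, hnk, levelInner]
  · simp [pure, component_incl, h, levelInner]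

lemma creation_pure (u : H) {n : ℕ} (x : Fin n → H) : creation J hα hq u (pure J hα hq x) =
    pure J hα hq (Fin.snoc x u : Fin (n + 1) → H) := creation_tprod J hα hq u x

lemma vacuum_eq_pure : vacuum J hα hq = pure J hα hq Fin.elim0 := rfl

lemma annihilation_pure_zero (u : H) (y : Fin 0 → H) :
    annihilation J hα hq u (pure J hα hq y) = 0 :=
  DirectSum.toModule_lof ℂ 0 _

lemma annihilation_pure_succ (u : H) {n : ℕ} (y : Fin (n + 1) → H) :
    annihilation J hα hq u (pure J hα hq y) =
      ∑ k, removalFunctional J α q u k (y k) • pure J hα hq (k.removeNth y) := by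
  refine (DirectSum.toModule_lof ℂ (n + 1) _).trans ?_
  simp [pure, LinearMap.uncurryMid]

lemma inner_creation_pure_left (u : H) {m n : ℕ} (x : Fin m → H) (y : Fin n → H) :
    inner ℂ (creation J hα hq u (pure J hα hq x)) (pure J hα hq y) =
      inner ℂ (pure J hα hq x) (annihilation J hα hq u (pure J hα hq y)) := by
  rw [creation_pure]
  cases n with
  | zero => rw [annihilation_pure_zero, inner_zero_right, inner_pure_of_ne (by omega)]
  | succ n =>
    simp only [annihilation_pure_succ, inner_sum, inner_smul_right]
    obtain rfl | hmn := eq_or_ne m n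
    · simp only [inner_pure, levelInner_snoc]
    · rw [inner_pure_of_ne (by omega)]
      simp only [inner_pure_of_ne hmn, mul_zero, Finset.sum_const_zero]

lemma inner_creation_left (u : H) (f g : FockSpace J hα hq) :
    inner ℂ (creation J hα hq u f) g = inner ℂ f (annihilation J hα hq u g) := by
  induction f using induction_pure with
  | smul c f hf => simp only [map_smul, inner_smul_left, hf]
  | add f f' hf hf' => simp only [map_add, inner_add_left, hf, hf']
  | pure m x =>
    induction g using induction_pure with
    | smul c f hf => simp only [map_smul, inner_smul_right, hf]
    | add f f' hf hf' => simp only [map_add, inner_add_right, hf, hf']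
    | pure n y => exact inner_creation_pure_left u x y

lemma creation_add (u v : H) :
    creation J hα hq (u + v) = creation J hα hq u + creation J hα hq v := by
  refine hom_ext fun n x => ?_
  simp only [LinearMap.add_apply, creation_pure]
  exact (congrArg (incl J hα hq (n + 1)) ((PiTensorProduct.tprod ℂ).snoc_add x u v)).trans
    (map_add _ _ _)

lemma creation_smul (c : ℂ) (u : H) : creation J hα hq (c • u) = c • creation J hα hq u := by
  refine hom_ext fun n x => ?_
  simp only [LinearMap.smul_apply, creation_pure]
  exact (congrArg (incl J hα hq (n + 1)) ((PiTensorProduct.tprod ℂ).snoc_smul x c u)).trans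
    (map_smul _ _ _)

end FockSpace

end AlgebraicFockSpace

lemma le_of_forall_pow_two_pow_le {a b M : ℝ} (hb : 0 ≤ b)
    (h : ∀ k : ℕ, a ^ 2 ^ k ≤ M * b ^ 2 ^ k) : a ≤ b := by
  by_contra! hba
  obtain rfl | hb := hb.eq_or_lt
  · have ha := h 0
    rw [pow_zero, pow_one, pow_one, mul_zero] at ha
    exact ha.not_gt hba
  · have hr : 1 < a / b := (one_lt_div hb).2 hba
    obtain ⟨n, hn⟩ := pow_unbounded_of_one_lt M hr
    have hM : (a / b) ^ 2 ^ n ≤ M := by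
      rw [div_pow, div_le_iff₀ (by positivity)]
      exact h n
    exact (hn.trans_le (pow_le_pow_right₀ hr.le Nat.lt_two_pow_self.le)).not_ge hM

section SymmetricOperators

variable {𝕜 V : Type*} [RCLike 𝕜] [SeminormedAddCommGroup V] [InnerProductSpace 𝕜 V]
  {T : V →ₗ[𝕜] V}

lemma sq_norm_pow_apply_le (hT : T.IsSymmetric) (m : ℕ) (f : V) :
    ‖(T ^ m) f‖ ^ 2 ≤ ‖f‖ * ‖(T ^ (2 * m)) f‖ := by
  have hinner : inner 𝕜 ((T ^ m) f) ((T ^ m) f) = inner 𝕜 f ((T ^ (2 * m)) f) := by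
    rw [(hT.pow m) f, two_mul, pow_add, Module.End.mul_apply]
  calc ‖(T ^ m) f‖ ^ 2 = RCLike.re (inner 𝕜 f ((T ^ (2 * m)) f)) := by
        rw [← hinner, inner_self_eq_norm_sq]
    _ ≤ ‖f‖ * ‖(T ^ (2 * m)) f‖ := re_inner_le_norm _ _

lemma norm_apply_pow_two_pow_mul_le (hT : T.IsSymmetric) (k : ℕ) (f : V) :
    ‖T f‖ ^ 2 ^ k * ‖f‖ ≤ ‖f‖ ^ 2 ^ k * ‖(T ^ 2 ^ k) f‖ := by
  obtain hf | hf := (norm_nonneg f).eq_or_lt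
  · rw [← hf, mul_zero]
    positivity
  induction k with
  | zero => simp only [pow_zero, pow_one, mul_comm, le_refl]
  | succ k ih =>
    refine le_of_mul_le_mul_right ?_ hf
    calc ‖T f‖ ^ 2 ^ (k + 1) * ‖f‖ * ‖f‖ = (‖T f‖ ^ 2 ^ k * ‖f‖) ^ 2 := by ring
      _ ≤ (‖f‖ ^ 2 ^ k * ‖(T ^ 2 ^ k) f‖) ^ 2 := pow_le_pow_left₀ (by positivity) ih 2
      _ = ‖f‖ ^ 2 ^ (k + 1) * ‖(T ^ 2 ^ k) f‖ ^ 2 := by ring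
      _ ≤ ‖f‖ ^ 2 ^ (k + 1) * (‖f‖ * ‖(T ^ (2 * 2 ^ k)) f‖) :=
        mul_le_mul_of_nonneg_left (sq_norm_pow_apply_le hT _ f) (by positivity)
      _ = ‖f‖ ^ 2 ^ (k + 1) * ‖(T ^ 2 ^ (k + 1)) f‖ * ‖f‖ := by rw [← pow_succ' 2 k]; ring

lemma norm_apply_le_of_forall_norm_pow_apply_le (hT : T.IsSymmetric) {f : V} {C K : ℝ}
    (hC : 0 ≤ C) (h : ∀ m : ℕ, ‖(T ^ m) f‖ ≤ K * C ^ m) : ‖T f‖ ≤ C * ‖f‖ := by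
  obtain hf | hf := (norm_nonneg f).eq_or_lt
  · have hsq := sq_norm_pow_apply_le hT 1 f
    rw [← hf, zero_mul, pow_one] at hsq
    rw [← hf, mul_zero]
    exact (sq_nonpos_iff _).1 hsq |>.le
  refine le_of_forall_pow_two_pow_le (M := K / ‖f‖) (by positivity) fun k => ?_
  rw [div_mul_eq_mul_div, le_div_iff₀ hf]
  calc ‖T f‖ ^ 2 ^ k * ‖f‖ ≤ ‖f‖ ^ 2 ^ k * ‖(T ^ 2 ^ k) f‖ :=
        norm_apply_pow_two_pow_mul_le hT k f
    _ ≤ ‖f‖ ^ 2 ^ k * (K * C ^ 2 ^ k) := mul_le_mul_of_nonneg_left (h _) (by positivity)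
    _ = K * (C * ‖f‖) ^ 2 ^ k := by ring

end SymmetricOperators

lemma sum_pow_val_le {r : ℝ} (hr₀ : 0 ≤ r) (hr₁ : r < 1) (n : ℕ) :
    ∑ k : Fin n, r ^ (k : ℕ) ≤ (1 - r)⁻¹ := by
  rw [← tsum_geometric_of_lt_one hr₀ hr₁, Fin.sum_univ_eq_sum_range (fun k => r ^ k)]
  exact (summable_geometric_of_lt_one hr₀ hr₁).sum_le_tsum _ fun _ _ => by positivity

section Boundedness

variable {H : Type*} [NormedAddCommGroup H] [InnerProductSpace ℂ H]

lemma SelfAdjointInvolution.norm_apply (J : SelfAdjointInvolution H) (x : H) :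
    ‖J.toLinearMap x‖ = ‖x‖ := by
  have hinner : inner ℂ (J.toLinearMap x) (J.toLinearMap x) = inner ℂ x x := by
    rw [J.symmetric, J.involutive]
  simp only [norm_eq_sqrt_re_inner (𝕜 := ℂ), hinner]

lemma norm_removalFunctional_le (J : SelfAdjointInvolution H) {α q : ℝ} (hα : |α| ≤ 1)
    (hq : |q| ≤ 1) (u y : H) {n : ℕ} (k : Fin (n + 1)) :
    ‖removalFunctional J α q u k y‖ ≤
      (|q| ^ (k.rev : ℕ) + |q| ^ (k : ℕ)) * (‖u‖ * ‖y‖) := by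
  have hcoeff : |α| * |q| ^ (n + k : ℕ) ≤ |q| ^ (k : ℕ) :=
    (mul_le_of_le_one_left (by positivity) hα).trans
      (pow_le_pow_of_le_one (abs_nonneg q) hq (Nat.le_add_left _ _))
  have hinner : ‖inner ℂ u (J.toLinearMap y)‖ ≤ ‖u‖ * ‖y‖ :=
    J.norm_apply y ▸ norm_inner_le_norm u (J.toLinearMap y)
  rw [removalFunctional_apply, add_mul]
  refine (norm_add_le _ _).trans (add_le_add ?_ ?_)
  · simpa using mul_le_mul_of_nonneg_left (norm_inner_le_norm u y)
      (pow_nonneg (abs_nonneg q) _)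
  · simpa using mul_le_mul hcoeff hinner (norm_nonneg _) (by positivity)

lemma sum_norm_removalFunctional_mul_le (J : SelfAdjointInvolution H) {α q : ℝ} (hα : |α| ≤ 1)
    (hq : |q| < 1) (u : H) {n : ℕ} (y : Fin (n + 1) → H) :
    ∑ k, ‖removalFunctional J α q u k (y k)‖ * ∏ i, ‖k.removeNth y i‖ ≤
      2 / (1 - |q|) * ‖u‖ * ∏ i, ‖y i‖ := by
  have hterm (k : Fin (n + 1)) :
      ‖removalFunctional J α q u k (y k)‖ * ∏ i, ‖k.removeNth y i‖ ≤
        (|q| ^ (k.rev : ℕ) + |q| ^ (k : ℕ)) * (‖u‖ * ∏ i, ‖y i‖) := by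
    have hprod : ‖y k‖ * ∏ i, ‖k.removeNth y i‖ = ∏ i, ‖y i‖ :=
      Fin.mul_prod_removeNth k fun i => ‖y i‖
    rw [← hprod, ← mul_assoc ‖u‖, ← mul_assoc]
    exact mul_le_mul_of_nonneg_right (norm_removalFunctional_le J hα hq.le u (y k) k)
      (by positivity)
  have hrev : ∑ k : Fin (n + 1), |q| ^ (k.rev : ℕ) = ∑ k : Fin (n + 1), |q| ^ (k : ℕ) :=
    Equiv.sum_comp Fin.revPerm fun k : Fin (n + 1) => |q| ^ (k : ℕ)
  have hgeom := sum_pow_val_le (abs_nonneg q) hq (n + 1)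
  calc ∑ k, ‖removalFunctional J α q u k (y k)‖ * ∏ i, ‖k.removeNth y i‖
      ≤ (2 * ∑ k : Fin (n + 1), |q| ^ (k : ℕ)) * (‖u‖ * ∏ i, ‖y i‖) := by
        refine (Finset.sum_le_sum fun k _ => hterm k).trans_eq ?_
        rw [← Finset.sum_mul, Finset.sum_add_distrib, hrev, two_mul]
    _ ≤ (2 * (1 - |q|)⁻¹) * (‖u‖ * ∏ i, ‖y i‖) := by gcongr
    _ = 2 / (1 - |q|) * ‖u‖ * ∏ i, ‖y i‖ := by ring

namespace FockSpace

variable {J : SelfAdjointInvolution H} {α q : ℝ} {hα : α ∈ Set.Ioo (-1 : ℝ) 1}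
  {hq : q ∈ Set.Ioo (-1 : ℝ) 1}

lemma norm_map_annihilation_pure_le {V : Type*} [SeminormedAddCommGroup V] [NormedSpace ℂ V]
    (g : FockSpace J hα hq →ₗ[ℂ] V) {n : ℕ} {M : ℝ} (hM : 0 ≤ M)
    (hg : ∀ x : Fin n → H, ‖g (pure J hα hq x)‖ ≤ M * ∏ i, ‖x i‖) (u : H) (y : Fin (n + 1) → H) :
    ‖g (annihilation J hα hq u (pure J hα hq y))‖ ≤
      2 / (1 - |q|) * ‖u‖ * M * ∏ i, ‖y i‖ := by
  rw [annihilation_pure_succ, map_sum]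
  calc ‖∑ k, g (removalFunctional J α q u k (y k) • pure J hα hq (k.removeNth y))‖
      ≤ ∑ k, ‖removalFunctional J α q u k (y k)‖ * (M * ∏ i, ‖k.removeNth y i‖) := by
        refine (norm_sum_le _ _).trans (Finset.sum_le_sum fun k _ => ?_)
        rw [map_smul, norm_smul]
        exact mul_le_mul_of_nonneg_left (hg _) (norm_nonneg _)
    _ = M * ∑ k, ‖removalFunctional J α q u k (y k)‖ * ∏ i, ‖k.removeNth y i‖ := by
        rw [Finset.mul_sum]
        exact Finset.sum_congr rfl fun k _ => by ring
    _ ≤ M * (2 / (1 - |q|) * ‖u‖ * ∏ i, ‖y i‖) :=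
        mul_le_mul_of_nonneg_left
          (sum_norm_removalFunctional_mul_le J (abs_le.2 ⟨hα.1.le, hα.2.le⟩) (abs_lt.2 hq) u y) hM
    _ = 2 / (1 - |q|) * ‖u‖ * M * ∏ i, ‖y i‖ := by ring

lemma inner_vacuum_vacuum : inner ℂ (vacuum J hα hq) (vacuum J hα hq) = 1 := by
  rw [vacuum_eq_pure, inner_pure, levelInner_eq_sum_signedPerm]
  simp [weight_signedPermEquiv]

lemma norm_inner_pure_pure_le {n : ℕ} (x y : Fin n → H) :
    ‖inner ℂ (pure J hα hq x) (pure J hα hq y)‖ ≤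
      (2 / (1 - |q|)) ^ n * (∏ i, ‖x i‖) * ∏ i, ‖y i‖ := by
  have hq' : 0 < 1 - |q| := sub_pos.2 (abs_lt.2 hq)
  induction n with
  | zero =>
    rw [Subsingleton.elim x Fin.elim0, Subsingleton.elim y Fin.elim0, ← vacuum_eq_pure,
      inner_vacuum_vacuum]
    simp
  | succ n ih =>
    obtain ⟨x, u, rfl⟩ : ∃ x' u, x = (Fin.snoc x' u : Fin (n + 1) → H) :=
      ⟨_, _, (Fin.snoc_init_self x).symm⟩
    rw [← creation_pure, inner_creation_left]
    refine (norm_map_annihilation_pure_le (innerₛₗ ℂ (pure J hα hq x)) (by positivity)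
      (fun y => ih x y) u y).trans_eq ?_
    simp only [Fin.prod_univ_castSucc (fun i => ‖(Fin.snoc x u : Fin (n + 1) → H) i‖),
      Fin.snoc_castSucc, Fin.snoc_last]
    ring

lemma norm_pure_le {n : ℕ} (x : Fin n → H) :
    ‖pure J hα hq x‖ ≤ √((2 / (1 - |q|)) ^ n) * ∏ i, ‖x i‖ := by
  have hq' : 0 < 1 - |q| := sub_pos.2 (abs_lt.2 hq)
  refine le_of_sq_le_sq ?_ (by positivity)
  calc ‖pure J hα hq x‖ ^ 2 ≤ ‖inner ℂ (pure J hα hq x) (pure J hα hq x)‖ := by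
        rw [inner_self_eq_norm_sq_to_K, norm_pow, RCLike.norm_ofReal, abs_norm]
    _ ≤ (2 / (1 - |q|)) ^ n * (∏ i, ‖x i‖) * ∏ i, ‖x i‖ := norm_inner_pure_pure_le x x
    _ = (√((2 / (1 - |q|)) ^ n) * ∏ i, ‖x i‖) ^ 2 := by
        rw [mul_pow, Real.sq_sqrt (by positivity)]
        ring

lemma norm_pow_annihilation_comp_creation_pure_le (u : H) (m : ℕ) {n : ℕ} (x : Fin n → H) :
    ‖((annihilation J hα hq u ∘ₗ creation J hα hq u) ^ m) (pure J hα hq x)‖ ≤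
      (2 / (1 - |q|) * ‖u‖ ^ 2) ^ m * √((2 / (1 - |q|)) ^ n) * ∏ i, ‖x i‖ := by
  have hq' : 0 < 1 - |q| := sub_pos.2 (abs_lt.2 hq)
  induction m generalizing n with
  | zero => simpa using norm_pure_le x
  | succ m ih =>
    rw [pow_succ, Module.End.mul_apply, LinearMap.comp_apply, creation_pure]
    refine (norm_map_annihilation_pure_le _ (by positivity) (fun y => ih y) u _).trans_eq ?_
    simp only [Fin.prod_univ_castSucc, Fin.snoc_castSucc, Fin.snoc_last]
    ring

lemma exists_norm_pow_annihilation_comp_creation_le (u : H) (f : FockSpace J hα hq) :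
    ∃ K : ℝ, ∀ m : ℕ, ‖((annihilation J hα hq u ∘ₗ creation J hα hq u) ^ m) f‖ ≤
      K * (2 / (1 - |q|) * ‖u‖ ^ 2) ^ m := by
  induction f using induction_pure with
  | pure n x =>
    exact ⟨_, fun m => (norm_pow_annihilation_comp_creation_pure_le u m x).trans_eq
      (by rw [mul_assoc, mul_comm])⟩
  | smul c f hf =>
    obtain ⟨K, hK⟩ := hf
    refine ⟨‖c‖ * K, fun m => ?_⟩
    rw [map_smul, norm_smul, mul_assoc]
    exact mul_le_mul_of_nonneg_left (hK m) (norm_nonneg c)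
  | add f g hf hg =>
    obtain ⟨K, hK⟩ := hf
    obtain ⟨L, hL⟩ := hg
    refine ⟨K + L, fun m => ?_⟩
    rw [map_add, add_mul]
    exact (norm_add_le _ _).trans (add_le_add (hK m) (hL m))

lemma isSymmetric_annihilation_comp_creation (u : H) :
    (annihilation J hα hq u ∘ₗ creation J hα hq u).IsSymmetric := fun f g => by
  rw [LinearMap.comp_apply, LinearMap.comp_apply, ← inner_creation_left, ← inner_conj_symm,
    ← inner_creation_left, inner_conj_symm]

lemma norm_creation_le (u : H) (f : FockSpace J hα hq) :
    ‖creation J hα hq u f‖ ≤ √(2 / (1 - |q|) * ‖u‖ ^ 2) * ‖f‖ := by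
  have hq' : 0 < 1 - |q| := sub_pos.2 (abs_lt.2 hq)
  obtain ⟨K, hK⟩ := exists_norm_pow_annihilation_comp_creation_le u f
  have hT := norm_apply_le_of_forall_norm_pow_apply_le
    (isSymmetric_annihilation_comp_creation u) (by positivity) hK
  refine le_of_sq_le_sq ?_ (by positivity)
  calc ‖creation J hα hq u f‖ ^ 2
      = RCLike.re (inner ℂ f (annihilation J hα hq u (creation J hα hq u f))) := by
        rw [← inner_creation_left, inner_self_eq_norm_sq]
    _ ≤ ‖f‖ * (2 / (1 - |q|) * ‖u‖ ^ 2 * ‖f‖) :=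
        (re_inner_le_norm _ _).trans (mul_le_mul_of_nonneg_left hT (norm_nonneg f))
    _ = (√(2 / (1 - |q|) * ‖u‖ ^ 2) * ‖f‖) ^ 2 := by
        rw [mul_pow, Real.sq_sqrt (by positivity)]
        ring

variable (J hα hq) in
/-- The bounded extension of the creation operator of `u` to the completed Fock space. -/
noncomputable def creationCLM (u : H) : Completed J hα hq →L[ℂ] Completed J hα hq :=
  ((creation J hα hq u).mkContinuous _ (norm_creation_le u)).completion

lemma creationCLM_coe (u : H) (f : FockSpace J hα hq) :
    creationCLM J hα hq u f = (creation J hα hq u f : FockSpace J hα hq) :=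
  ContinuousLinearMap.completion_apply_coe _ f

lemma clm_ext {A B : Completed J hα hq →L[ℂ] Completed J hα hq}
    (h : ∀ f : FockSpace J hα hq, A f = B f) : A = B := by
  ext z
  induction z using UniformSpace.Completion.induction_on with
  | hp => exact isClosed_eq A.continuous B.continuous
  | ih f => exact h f

lemma isCreation_iff (u : H) (C : Completed J hα hq →L[ℂ] Completed J hα hq) :
    IsCreation J hα hq u C ↔ C = creationCLM J hα hq u := by
  constructor
  · exact fun h => clm_ext fun f => (h f).trans (creationCLM_coe u f).symm
  · rintro rfl
    exact creationCLM_coe u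

variable (J hα hq) in
/-- The Gaussian operator `B(u) + B*(u)` on the completed Fock space. -/
noncomputable def gaussian (u : H) : Completed J hα hq →L[ℂ] Completed J hα hq :=
  ContinuousLinearMap.adjoint (creationCLM J hα hq u) + creationCLM J hα hq u

lemma isGaussian_iff (u : H) (G : Completed J hα hq →L[ℂ] Completed J hα hq) :
    IsGaussian J hα hq u G ↔ G = gaussian J hα hq u := by
  simp [IsGaussian, isCreation_iff, gaussian]

lemma star_gaussian (u : H) : star (gaussian J hα hq u) = gaussian J hα hq u := by
  rw [ContinuousLinearMap.star_eq_adjoint, gaussian, map_add, ContinuousLinearMap.adjoint_adjoint,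
    add_comm]

lemma star_creationCLM_coe (u : H) (f : FockSpace J hα hq) :
    star (creationCLM J hα hq u) f =
      (annihilation J hα hq u f : FockSpace J hα hq) := by
  refine ext_inner_left ℂ fun z => ?_
  induction z using UniformSpace.Completion.induction_on with
  | hp => exact isClosed_eq (by fun_prop) (by fun_prop)
  | ih g =>
    rw [ContinuousLinearMap.star_eq_adjoint, ContinuousLinearMap.adjoint_inner_right,
      creationCLM_coe, UniformSpace.Completion.inner_coe,
      UniformSpace.Completion.inner_coe, inner_creation_left]

lemma gaussian_coe (u : H) (f : FockSpace J hα hq) : gaussian J hα hq u f =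
    ((annihilation J hα hq u f + creation J hα hq u f : FockSpace J hα hq) :
      Completed J hα hq) := by
  rw [UniformSpace.Completion.coe_add, ← creationCLM_coe, ← star_creationCLM_coe]
  rfl

end FockSpace

end Boundedness

/-- The inner product which `⟨·, ·⟩_{α,q}` induces on the one-particle space. -/
noncomputable def oneParticleInner {H : Type*} [NormedAddCommGroup H] [InnerProductSpace ℂ H]
    (J : SelfAdjointInvolution H) (α : ℝ) (x y : H) : ℂ :=
  inner ℂ x y + α * inner ℂ x (J.toLinearMap y)

section VacuumMoments

variable {H : Type*} [NormedAddCommGroup H] [InnerProductSpace ℂ H] {J : SelfAdjointInvolution H}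
  {α : ℝ}

lemma conj_oneParticleInner (x y : H) :
    starRingEnd ℂ (oneParticleInner J α x y) = oneParticleInner J α y x := by
  simp only [oneParticleInner, map_add, map_mul, inner_conj_symm, Complex.conj_ofReal,
    J.symmetric y x]

lemma oneParticleInner_self_ne_zero (hα : |α| < 1) {x : H} (hx : x ≠ 0) :
    oneParticleInner J α x x ≠ 0 := by
  intro h
  have hJ : ‖inner ℂ x (J.toLinearMap x)‖ ≤ ‖x‖ ^ 2 := by
    simpa only [J.norm_apply, sq] using norm_inner_le_norm (𝕜 := ℂ) x (J.toLinearMap x)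
  have hself : ‖x‖ ^ 2 = |α| * ‖inner ℂ x (J.toLinearMap x)‖ := by
    have hnorm := congrArg norm (eq_neg_of_add_eq_zero_left h)
    simpa [inner_self_eq_norm_sq_to_K] using hnorm
  have hpos : 0 < ‖x‖ ^ 2 := by positivity
  nlinarith [abs_nonneg α]

namespace FockSpace

variable {q : ℝ} {hα : α ∈ Set.Ioo (-1 : ℝ) 1} {hq : q ∈ Set.Ioo (-1 : ℝ) 1}

lemma annihilation_vacuum (u : H) : annihilation J hα hq u (vacuum J hα hq) = 0 :=
  annihilation_pure_zero u _

lemma creation_vacuum (u : H) : creation J hα hq u (vacuum J hα hq) = pure J hα hq ![u] := by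
  rw [vacuum_eq_pure, creation_pure]
  congr 1
  ext i
  fin_cases i
  rfl

lemma gaussian_vacuum (u : H) : gaussian J hα hq u (vacuum J hα hq : Completed J hα hq) =
    (pure J hα hq ![u] : Completed J hα hq) := by
  rw [gaussian_coe, annihilation_vacuum, creation_vacuum, zero_add]

lemma creation_pure_one (u v : H) :
    creation J hα hq u (pure J hα hq ![v]) = pure J hα hq ![v, u] := by
  rw [creation_pure]
  congr 1
  ext i
  fin_cases i <;> rfl

lemma annihilation_pure_one (u v : H) : annihilation J hα hq u (pure J hα hq ![v]) =
    oneParticleInner J α u v • vacuum J hα hq := by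
  rw [annihilation_pure_succ, Fin.sum_univ_one, removalFunctional_apply, vacuum_eq_pure,
    Subsingleton.elim (Fin.removeNth 0 ![v]) Fin.elim0]
  simp [oneParticleInner]

lemma annihilation_pure_two (u v w : H) : annihilation J hα hq u (pure J hα hq ![v, w]) =
    (q * oneParticleInner J α u v) • pure J hα hq ![w] +
      (inner ℂ u w + α * q ^ 2 * inner ℂ u (J.toLinearMap w)) • pure J hα hq ![v] := by
  have hremove₀ : Fin.removeNth 0 ![v, w] = ![w] := by
    ext k
    fin_cases k
    rfl
  have hremove₁ : Fin.removeNth 1 ![v, w] = ![v] := by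
    ext k
    fin_cases k
    rfl
  rw [annihilation_pure_succ, Fin.sum_univ_two, hremove₀, hremove₁]
  congr 2
  · simp [removalFunctional_apply, oneParticleInner]
    ring
  · simp [removalFunctional_apply]

lemma inner_pure_one (u v : H) :
    inner ℂ (pure J hα hq ![u]) (pure J hα hq ![v]) = oneParticleInner J α u v := by
  rw [← creation_vacuum, inner_creation_left, annihilation_pure_one, inner_smul_right,
    inner_vacuum_vacuum, mul_one]

lemma inner_pure_two (x y z w : H) :
    inner ℂ (pure J hα hq ![x, y]) (pure J hα hq ![w, z]) =
      q * oneParticleInner J α y w * oneParticleInner J α x z +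
        (inner ℂ y z + α * q ^ 2 * inner ℂ y (J.toLinearMap z)) * oneParticleInner J α x w := by
  rw [← creation_pure_one, inner_creation_left, annihilation_pure_two, inner_add_right,
    inner_smul_right, inner_smul_right, inner_pure_one, inner_pure_one]

lemma inner_gaussian_left (u : H) (z w : Completed J hα hq) :
    inner ℂ (gaussian J hα hq u z) w = inner ℂ z (gaussian J hα hq u w) := by
  rw [← ContinuousLinearMap.adjoint_inner_right, ← ContinuousLinearMap.star_eq_adjoint,
    star_gaussian]

lemma vacuumState_gaussian_mul_gaussian (x y : H) :
    vacuumState J hα hq (gaussian J hα hq x * gaussian J hα hq y) = oneParticleInner J α x y := by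
  rw [vacuumState, mul_apply_eq_comp, ← inner_gaussian_left, gaussian_vacuum, gaussian_vacuum,
    UniformSpace.Completion.inner_coe, inner_pure_one]

lemma gaussian_gaussian_vacuum (x y : H) :
    gaussian J hα hq x (gaussian J hα hq y (vacuum J hα hq : Completed J hα hq)) =
      ((oneParticleInner J α x y • vacuum J hα hq + pure J hα hq ![y, x] : FockSpace J hα hq) :
        Completed J hα hq) := by
  rw [gaussian_vacuum, gaussian_coe, annihilation_pure_one, creation_pure_one]

lemma vacuumState_gaussian_four (x y z w : H) :
    vacuumState J hα hq (gaussian J hα hq x * (gaussian J hα hq y *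
      (gaussian J hα hq z * gaussian J hα hq w))) =
      oneParticleInner J α x y * oneParticleInner J α z w +
        (q * oneParticleInner J α y w * oneParticleInner J α x z +
          (inner ℂ y z + α * q ^ 2 * inner ℂ y (J.toLinearMap z)) * oneParticleInner J α x w) := by
  have inner_vacuum_pure (v : Fin 2 → H) : inner ℂ (vacuum J hα hq) (pure J hα hq v) = 0 :=
    inner_pure_of_ne (by omega) _ _
  have inner_pure_vacuum (v : Fin 2 → H) : inner ℂ (pure J hα hq v) (vacuum J hα hq) = 0 :=
    inner_pure_of_ne (by omega) _ _
  simp only [vacuumState, mul_apply_eq_comp]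
  rw [← inner_gaussian_left, ← inner_gaussian_left, gaussian_gaussian_vacuum,
    gaussian_gaussian_vacuum, UniformSpace.Completion.inner_coe]
  simp only [inner_add_left, inner_add_right, inner_smul_left, inner_smul_right,
    inner_vacuum_vacuum, inner_vacuum_pure, inner_pure_vacuum, inner_pure_two,
    conj_oneParticleInner, mul_one, mul_zero, add_zero, zero_add]
  ring

end FockSpace

end VacuumMoments

lemma exists_ne_zero_apply_eq_zero {𝕜 V : Type*} [Field 𝕜] [AddCommGroup V] [Module 𝕜 V]
    (hdim : 1 < Module.rank 𝕜 V) (f : V →ₗ[𝕜] 𝕜) : ∃ v ≠ 0, f v = 0 := by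
  by_contra! hf
  have hinj : Function.Injective f :=
    (injective_iff_map_eq_zero f).2 fun v hv => of_not_not fun hv₀ => hf v hv₀ hv
  have hrank := LinearMap.lift_rank_le_of_injective f hinj
  rw [Module.rank_self, Cardinal.lift_one, Cardinal.lift_le_one_iff] at hrank
  exact hrank.not_gt hdim

lemma Complexification.ofReal_ne_zero {E : Type*} [NormedAddCommGroup E] {x : E} (hx : x ≠ 0) :
    ofReal x ≠ 0 := fun h => hx (congrArg re h)

section NotTrace

variable {E : Type*} [NormedAddCommGroup E] [InnerProductSpace ℝ E]

namespace Complexification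

lemma eq_zero_of_inner_ofReal {z : Complexification E} (h : ∀ y : E, inner ℂ z (ofReal y) = 0) :
    z = 0 := by
  have hre := congrArg Complex.re (h z.re)
  have him := congrArg Complex.im (h z.im)
  simp only [inner_def, ofReal, inner_zero_right, add_zero, zero_sub, Complex.zero_re,
    Complex.zero_im, neg_eq_zero] at hre him
  exact Complexification.ext (inner_self_eq_zero.1 hre) (inner_self_eq_zero.1 him)

lemma inner_ofReal_comm (x y : E) :
    inner ℂ (ofReal x) (ofReal y) = inner ℂ (ofReal y) (ofReal x) := by
  rw [inner_ofReal, inner_ofReal, real_inner_comm]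

lemma re_inner_ofReal_right (z : Complexification E) (y : E) :
    (inner ℂ z (ofReal y)).re = inner ℝ z.re y := by
  simp [inner_def, ofReal]

end Complexification

open Complexification

namespace FockSpace

variable {J : SelfAdjointInvolution (Complexification E)} {α q : ℝ}
  {hα : α ∈ Set.Ioo (-1 : ℝ) 1} {hq : q ∈ Set.Ioo (-1 : ℝ) 1}
  {A : VonNeumannAlgebra (Completed J hα hq)}

lemma inner_involution_ofReal_comm (hα₀ : α ≠ 0) (hA : ∀ x : E, gaussian J hα hq (ofReal x) ∈ A)
    (htr : IsTraceOn A (vacuumState J hα hq)) (x y : E) :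
    inner ℂ (ofReal x) (J.toLinearMap (ofReal y)) =
      inner ℂ (ofReal y) (J.toLinearMap (ofReal x)) := by
  have htwo := htr _ (hA x) _ (hA y)
  rw [vacuumState_gaussian_mul_gaussian, vacuumState_gaussian_mul_gaussian, oneParticleInner,
    oneParticleInner, inner_ofReal_comm] at htwo
  exact mul_left_cancel₀ (Complex.ofReal_ne_zero.2 hα₀) (add_left_cancel htwo)

lemma oneParticleInner_mul_inner_involution (hα₀ : α ≠ 0)
    (hA : ∀ x : E, gaussian J hα hq (ofReal x) ∈ A)
    (htr : IsTraceOn A (vacuumState J hα hq)) (x y z w : E) :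
    oneParticleInner J α (ofReal x) (ofReal y) *
        inner ℂ (ofReal z) (J.toLinearMap (ofReal w)) =
      oneParticleInner J α (ofReal x) (ofReal w) *
        inner ℂ (ofReal y) (J.toLinearMap (ofReal z)) := by
  have hcomm (a b : E) : oneParticleInner J α (ofReal a) (ofReal b) =
      oneParticleInner J α (ofReal b) (ofReal a) := by
    rw [oneParticleInner, oneParticleInner, inner_ofReal_comm,
      inner_involution_ofReal_comm hα₀ hA htr]
  have hfour := htr _ (hA x) _ (mul_mem (hA y) (mul_mem (hA z) (hA w)))
  rw [mul_assoc (gaussian J hα hq (ofReal y)), mul_assoc (gaussian J hα hq (ofReal z)),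
    vacuumState_gaussian_four, vacuumState_gaussian_four, hcomm w x, hcomm z x, hcomm y x] at hfour
  have hq₁ : (1 - q ^ 2 : ℂ) ≠ 0 := by
    have hsq : q ^ 2 < 1 := (sq_lt_one_iff_abs_lt_one q).2 (abs_lt.2 hq)
    exact_mod_cast (sub_pos.2 hsq).ne'
  refine mul_left_cancel₀ (mul_ne_zero (Complex.ofReal_ne_zero.2 hα₀) hq₁) ?_
  have hzw : oneParticleInner J α (ofReal z) (ofReal w) = inner ℂ (ofReal z) (ofReal w) +
    α * inner ℂ (ofReal z) (J.toLinearMap (ofReal w)) := rfl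
  have hyz : oneParticleInner J α (ofReal y) (ofReal z) = inner ℂ (ofReal y) (ofReal z) +
    α * inner ℂ (ofReal y) (J.toLinearMap (ofReal z)) := rfl
  rw [hzw, hyz] at hfour
  linear_combination hfour

lemma exists_ne_zero_inner_involution_eq_zero (hdim : 2 ≤ Module.rank ℝ E) (hα₀ : α ≠ 0)
    (hA : ∀ x : E, gaussian J hα hq (ofReal x) ∈ A)
    (htr : IsTraceOn A (vacuumState J hα hq)) (x : E) :
    ∃ z ≠ 0, inner ℂ (ofReal x) (J.toLinearMap (ofReal z)) = 0 := by
  obtain ⟨z, hz₀, hz⟩ := exists_ne_zero_apply_eq_zero (Cardinal.one_lt_two.trans_le hdim)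
    (innerₛₗ ℝ (J.toLinearMap (ofReal x)).re)
  refine ⟨z, hz₀, Complex.ext ?_ (Complex.conj_eq_iff_im.1 ?_)⟩
  · rw [← J.symmetric, re_inner_ofReal_right]
    exact hz
  · rw [inner_conj_symm, J.symmetric, inner_involution_ofReal_comm hα₀ hA htr]

theorem not_isTraceOn_vacuumState (hdim : 2 ≤ Module.rank ℝ E) (hα₀ : α ≠ 0)
    (hA : ∀ x : E, gaussian J hα hq (ofReal x) ∈ A) : ¬ IsTraceOn A (vacuumState J hα hq) := by
  intro htr
  have : Nontrivial E :=
    rank_pos_iff_nontrivial.1 (zero_lt_one.trans (Cardinal.one_lt_two.trans_le hdim))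
  obtain ⟨e, he⟩ := exists_ne (0 : E)
  obtain ⟨z, hz₀, hez⟩ := exists_ne_zero_inner_involution_eq_zero hdim hα₀ hA htr e
  have hc : oneParticleInner J α (ofReal e) (ofReal e) ≠ 0 :=
    oneParticleInner_self_ne_zero (abs_lt.2 hα) (ofReal_ne_zero he)
  have hJz : J.toLinearMap (ofReal z) = 0 := eq_zero_of_inner_ofReal fun y => by
    have hmul := oneParticleInner_mul_inner_involution hα₀ hA htr e e z y
    rw [hez, mul_zero] at hmul
    rw [J.symmetric]
    exact (mul_eq_zero.1 hmul).resolve_left hc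
  exact ofReal_ne_zero hz₀ (by rw [← J.involutive (ofReal z), hJz, map_zero])

end FockSpace

end NotTrace

section VectorStateTrace

variable {K : Type*} [NormedAddCommGroup K] [InnerProductSpace ℂ K] [CompleteSpace K]

lemma subset_generatedVonNeumannAlgebra (S : Set (K →L[ℂ] K)) :
    S ⊆ generatedVonNeumannAlgebra S := fun _ hT =>
  (StarSubalgebra.mem_centralizer_iff ℂ).2 fun _ hU =>
    ⟨((StarSubalgebra.mem_centralizer_iff ℂ |>.1 hU) _ hT).1.symm,
      ((StarSubalgebra.mem_centralizer_iff ℂ |>.1 (star_mem hU)) _ hT).1.symm⟩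

lemma mem_commutant_generatedVonNeumannAlgebra {S : Set (K →L[ℂ] K)} {U : K →L[ℂ] K}
    (hU : ∀ G ∈ S, G * U = U * G ∧ star G * U = U * star G) :
    U ∈ (generatedVonNeumannAlgebra S).commutant :=
  VonNeumannAlgebra.mem_commutant_iff.2 fun _ hT =>
    ((StarSubalgebra.mem_centralizer_iff ℂ |>.1 hT) U
      (StarSubalgebra.mem_centralizer_iff ℂ |>.2 hU)).1.symm

/-- An operator `b` of the commutant of `A` which, together with its adjoint, acts on the vector
`Ω` in the same way as `a ∈ A`. For a trace vector `Ω` this is right multiplication by `a`. -/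
structure IsCommutantPartner (A : VonNeumannAlgebra K) (Ω : K) (a b : K →L[ℂ] K) : Prop where
  mem : a ∈ A
  mem_commutant : b ∈ A.commutant
  apply_eq : b Ω = a Ω
  star_apply_eq : star b Ω = star a Ω

variable {A : VonNeumannAlgebra K} {Ω : K}

namespace IsCommutantPartner

variable {a a' b b' S : K →L[ℂ] K}

lemma apply_comm (h : IsCommutantPartner A Ω a b) (hS : S ∈ A) (z : K) : S (b z) = b (S z) :=
  congrArg (fun T : K →L[ℂ] K => T z) (VonNeumannAlgebra.mem_commutant_iff.1 h.mem_commutant S hS)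

protected lemma star (h : IsCommutantPartner A Ω a b) :
    IsCommutantPartner A Ω (star a) (star b) where
  mem := star_mem h.mem
  mem_commutant := star_mem h.mem_commutant
  apply_eq := h.star_apply_eq
  star_apply_eq := by simpa only [star_star] using h.apply_eq

protected lemma one : IsCommutantPartner A Ω 1 1 := ⟨one_mem A, one_mem _, rfl, rfl⟩

protected lemma zero : IsCommutantPartner A Ω 0 0 := ⟨zero_mem A, zero_mem _, rfl, rfl⟩

protected lemma add (h : IsCommutantPartner A Ω a b) (h' : IsCommutantPartner A Ω a' b') :
    IsCommutantPartner A Ω (a + a') (b + b') where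
  mem := add_mem h.mem h'.mem
  mem_commutant := add_mem h.mem_commutant h'.mem_commutant
  apply_eq := congrArg₂ (· + ·) h.apply_eq h'.apply_eq
  star_apply_eq := by
    rw [star_add, star_add, add_apply, add_apply, h.star_apply_eq, h'.star_apply_eq]

protected lemma smul (c : ℂ) (h : IsCommutantPartner A Ω a b) :
    IsCommutantPartner A Ω (c • a) (c • b) where
  mem := A.toStarSubalgebra.smul_mem h.mem c
  mem_commutant := A.commutant.toStarSubalgebra.smul_mem h.mem_commutant c
  apply_eq := congrArg (c • ·) h.apply_eq
  star_apply_eq := by rw [star_smul, star_smul, smul_apply, smul_apply, h.star_apply_eq]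

lemma mul_apply_eq (h : IsCommutantPartner A Ω a b) (h' : IsCommutantPartner A Ω a' b') :
    (b' * b) Ω = (a * a') Ω := by
  rw [mul_apply_eq_comp, mul_apply_eq_comp, h.apply_eq, ← h'.apply_comm h.mem, h'.apply_eq]

protected lemma mul (h : IsCommutantPartner A Ω a b) (h' : IsCommutantPartner A Ω a' b') :
    IsCommutantPartner A Ω (a * a') (b' * b) where
  mem := mul_mem h.mem h'.mem
  mem_commutant := mul_mem h'.mem_commutant h.mem_commutant
  apply_eq := h.mul_apply_eq h'
  star_apply_eq := by simpa only [star_mul] using h'.star.mul_apply_eq h.star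

lemma inner_apply_comm (h : IsCommutantPartner A Ω a b) (hS : S ∈ A) :
    inner ℂ Ω (S (a Ω)) = inner ℂ Ω (a (S Ω)) := by
  rw [← h.apply_eq, h.apply_comm hS, ← ContinuousLinearMap.adjoint_inner_left,
    ← ContinuousLinearMap.star_eq_adjoint, h.star_apply_eq, ContinuousLinearMap.star_eq_adjoint,
    ContinuousLinearMap.adjoint_inner_left]

lemma norm_star_apply (h : IsCommutantPartner A Ω a b) : ‖star a Ω‖ = ‖a Ω‖ := by
  have hinner := h.inner_apply_comm (star_mem h.mem)
  rw [ContinuousLinearMap.star_eq_adjoint, ContinuousLinearMap.adjoint_inner_right,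
    ← ContinuousLinearMap.adjoint_inner_left a _ Ω, inner_self_eq_norm_sq_to_K,
    inner_self_eq_norm_sq_to_K] at hinner
  have hsq : ‖a Ω‖ ^ 2 = ‖star a Ω‖ ^ 2 := by exact_mod_cast hinner
  exact ((sq_eq_sq₀ (norm_nonneg _) (norm_nonneg _)).1 hsq).symm

end IsCommutantPartner

variable (A Ω) in
/-- The vectors `a Ω` for those `a ∈ A` which have a partner in the commutant of `A`. -/
def partnerSubmodule : Submodule ℂ K where
  carrier := {z | ∃ a b, IsCommutantPartner A Ω a b ∧ a Ω = z}
  zero_mem' := ⟨0, 0, .zero, rfl⟩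
  add_mem' := by
    rintro _ _ ⟨a, b, h, rfl⟩ ⟨a', b', h', rfl⟩
    exact ⟨_, _, h.add h', rfl⟩
  smul_mem' := by
    rintro c _ ⟨a, b, h, rfl⟩
    exact ⟨_, _, h.smul c, rfl⟩

lemma mem_partnerSubmodule_self : Ω ∈ partnerSubmodule A Ω := ⟨1, 1, .one, rfl⟩

lemma IsCommutantPartner.apply_mem_partnerSubmodule {a b : K →L[ℂ] K}
    (h : IsCommutantPartner A Ω a b) {z : K} (hz : z ∈ partnerSubmodule A Ω) :
    a z ∈ partnerSubmodule A Ω := by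
  obtain ⟨a', b', h', rfl⟩ := hz
  exact ⟨_, _, h.mul h', rfl⟩

lemma norm_inner_apply_apply_le (hdense : Dense (partnerSubmodule A Ω : Set K)) {D : K →L[ℂ] K}
    (hD : D ∈ A) (z : K) : ‖inner ℂ Ω (D z)‖ ≤ ‖D Ω‖ * ‖z‖ := by
  refine hdense.induction (P := fun z => ‖inner ℂ Ω (D z)‖ ≤ ‖D Ω‖ * ‖z‖) ?_
    (isClosed_le (by fun_prop) (by fun_prop)) z
  rintro _ ⟨a, b, h, rfl⟩
  rw [h.inner_apply_comm hD, ← ContinuousLinearMap.adjoint_inner_left, ← h.norm_star_apply,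
    mul_comm]
  exact norm_inner_le_norm _ _

/-- Replacing `T ∈ A` by a partnered operator changes both sides of the
trace identity by at most a multiple of the distance of the vacuum vectors. -/
theorem isTraceOn_of_dense_partnerSubmodule (hdense : Dense (partnerSubmodule A Ω : Set K)) :
    IsTraceOn A fun T => inner ℂ Ω (T Ω) := by
  intro S hS T hT
  suffices h : ∀ z : K, ‖inner ℂ Ω (S (T Ω)) - inner ℂ Ω (T (S Ω))‖ ≤
      (‖star S Ω‖ + ‖S Ω‖) * ‖z - T Ω‖ by
    simpa [sub_eq_zero] using h (T Ω)
  refine fun z => hdense.induction (P := fun z => ‖inner ℂ Ω (S (T Ω)) - inner ℂ Ω (T (S Ω))‖ ≤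
    (‖star S Ω‖ + ‖S Ω‖) * ‖z - T Ω‖) ?_ (isClosed_le (by fun_prop) (by fun_prop)) z
  rintro _ ⟨a, b, h, rfl⟩
  have hdiff : inner ℂ Ω (S (T Ω)) - inner ℂ Ω (T (S Ω)) =
      inner ℂ Ω ((a - T) (S Ω)) - inner ℂ (star S Ω) ((a - T) Ω) := by
    rw [ContinuousLinearMap.star_eq_adjoint, ContinuousLinearMap.adjoint_inner_left]
    simp only [sub_apply, map_sub, inner_sub_right, h.inner_apply_comm hS]
    ring
  calc ‖inner ℂ Ω (S (T Ω)) - inner ℂ Ω (T (S Ω))‖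
      ≤ ‖inner ℂ Ω ((a - T) (S Ω))‖ + ‖inner ℂ (star S Ω) ((a - T) Ω)‖ := by
        rw [hdiff]
        exact norm_sub_le _ _
    _ ≤ ‖(a - T) Ω‖ * ‖S Ω‖ + ‖star S Ω‖ * ‖(a - T) Ω‖ :=
        add_le_add (norm_inner_apply_apply_le hdense (sub_mem h.mem hT) _) (norm_inner_le_norm _ _)
    _ = (‖star S Ω‖ + ‖S Ω‖) * ‖a Ω - T Ω‖ := by
        rw [sub_apply]
        ring

end VectorStateTrace

section OrderReversal

variable {H : Type*} [NormedAddCommGroup H] [InnerProductSpace ℂ H]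

lemma weight_signedPermEquiv_revPerm_permCongr (α q : ℝ) {n : ℕ} (π : Equiv.Perm (Fin n)) :
    weight α q (signedPermEquiv (Fin.revPerm.permCongr π, 1)) =
      weight α q (signedPermEquiv (π, 1)) := by
  have pairWeight_one (a b : Fin n) : pairWeight q (a, 1) (b, 1) = if b < a then q else 1 := by
    have hsum : ¬ ((a : ℕ) : ℤ) + 1 + (b + 1) < 0 := by omega
    simp [pairWeight, SignedIndex.val, hsum]
  simp only [weight_signedPermEquiv, Pi.one_apply, if_true, Finset.prod_const_one, one_mul,
    pairWeight_one]
  rw [← Equiv.prod_comp Fin.revPerm, Finset.prod_comm, ← Equiv.prod_comp Fin.revPerm]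
  simp

lemma levelInner_zero_tprod (J : SelfAdjointInvolution H) (q : ℝ) {n : ℕ} (x y : Fin n → H) :
    levelInner J 0 q n (PiTensorProduct.tprod ℂ x) (PiTensorProduct.tprod ℂ y) =
      ∑ π : Equiv.Perm (Fin n), (weight 0 q (signedPermEquiv (π, 1)) : ℂ) *
        ∏ j, inner ℂ (x j) (y (π j)) := by
  rw [levelInner_eq_sum_signedPerm]
  refine Finset.sum_congr rfl fun π _ => ?_
  rw [Finset.sum_eq_single 1]
  · simp [SelfAdjointInvolution.sign]
  · intro s _ hs
    obtain ⟨k, hk⟩ := Function.ne_iff.1 hs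
    rw [weight_signedPermEquiv, Finset.prod_eq_zero (Finset.mem_univ k) (if_neg hk)]
    simp
  · simp

lemma levelInner_zero_tprod_rev (J : SelfAdjointInvolution H) (q : ℝ) {n : ℕ} (x y : Fin n → H) :
    levelInner J 0 q n (PiTensorProduct.tprod ℂ (x ∘ Fin.rev))
        (PiTensorProduct.tprod ℂ (y ∘ Fin.rev)) =
      levelInner J 0 q n (PiTensorProduct.tprod ℂ x) (PiTensorProduct.tprod ℂ y) := by
  rw [levelInner_zero_tprod, levelInner_zero_tprod, ← (Fin.revPerm.permCongr).sum_comp]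
  refine Finset.sum_congr rfl fun π _ => ?_
  rw [weight_signedPermEquiv_revPerm_permCongr, ← Equiv.prod_comp Fin.revPerm]
  simp

namespace FockSpace

section Algebraic

variable (J : SelfAdjointInvolution H) {α q : ℝ} (hα : α ∈ Set.Ioo (-1 : ℝ) 1)
  (hq : q ∈ Set.Ioo (-1 : ℝ) 1)

/-- The reversal of the order of the tensor factors. It exchanges left and right creation
operators, and it is unitary for `α = 0`. -/
noncomputable def flip : FockSpace J hα hq →ₗ[ℂ] FockSpace J hα hq :=
  DirectSum.toModule ℂ ℕ _ fun n => incl J hα hq n ∘ₗ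
    (PiTensorProduct.reindex ℂ (fun _ : Fin n => H) Fin.revPerm).toLinearMap

/-- The operator `q ^ N`, where `N` is the number operator. -/
noncomputable def qPow : FockSpace J hα hq →ₗ[ℂ] FockSpace J hα hq :=
  DirectSum.toModule ℂ ℕ _ fun n => (q : ℂ) ^ n • incl J hα hq n

/-- The left creation operator `x₁ ⊗ ⋯ ⊗ xₙ ↦ u ⊗ x₁ ⊗ ⋯ ⊗ xₙ`. -/
noncomputable def leftCreation (u : H) : FockSpace J hα hq →ₗ[ℂ] FockSpace J hα hq :=
  flip J hα hq ∘ₗ creation J hα hq u ∘ₗ flip J hα hq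

/-- The mirror image of the right annihilation operator, which for `α = 0` is the adjoint of
left creation. -/
noncomputable def leftAnnihilation (u : H) : FockSpace J hα hq →ₗ[ℂ] FockSpace J hα hq :=
  flip J hα hq ∘ₗ annihilation J hα hq u ∘ₗ flip J hα hq

variable {J hα hq}

lemma flip_pure {n : ℕ} (x : Fin n → H) :
    flip J hα hq (pure J hα hq x) = pure J hα hq (x ∘ Fin.rev) :=
  (DirectSum.toModule_lof ℂ n _).trans
    (congrArg (incl J hα hq n) (PiTensorProduct.reindex_tprod Fin.revPerm x))

lemma flip_vacuum : flip J hα hq (vacuum J hα hq) = vacuum J hα hq := by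
  rw [vacuum_eq_pure, flip_pure, Subsingleton.elim (Fin.elim0 ∘ Fin.rev) Fin.elim0]

lemma flip_flip (f : FockSpace J hα hq) : flip J hα hq (flip J hα hq f) = f := by
  have hcomp : flip J hα hq ∘ₗ flip J hα hq = LinearMap.id := hom_ext fun n x => by
    rw [LinearMap.comp_apply, flip_pure, flip_pure, LinearMap.id_apply, Function.comp_assoc,
      Fin.rev_involutive.comp_self, Function.comp_id]
  exact LinearMap.congr_fun hcomp f

lemma qPow_pure {n : ℕ} (x : Fin n → H) :
    qPow J hα hq (pure J hα hq x) = (q : ℂ) ^ n • pure J hα hq x :=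
  DirectSum.toModule_lof ℂ n _

lemma flip_qPow_flip (f : FockSpace J hα hq) :
    flip J hα hq (qPow J hα hq (flip J hα hq f)) = qPow J hα hq f := by
  have hcomp : flip J hα hq ∘ₗ qPow J hα hq ∘ₗ flip J hα hq = qPow J hα hq :=
    hom_ext fun n x => by
      rw [LinearMap.comp_apply, LinearMap.comp_apply, flip_pure, qPow_pure, map_smul, ← flip_pure,
        flip_flip, qPow_pure]
  exact LinearMap.congr_fun hcomp f

lemma leftCreation_pure (u : H) {n : ℕ} (x : Fin n → H) :
    leftCreation J hα hq u (pure J hα hq x) =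
      pure J hα hq (Fin.cons u x : Fin (n + 1) → H) := by
  rw [leftCreation, LinearMap.comp_apply, LinearMap.comp_apply, flip_pure, creation_pure,
    flip_pure]
  congr 1
  ext k
  induction k using Fin.cases with
  | zero => simp
  | succ k => simp [Fin.rev_succ]

lemma leftCreation_creation (u v : H) (f : FockSpace J hα hq) :
    leftCreation J hα hq u (creation J hα hq v f) =
      creation J hα hq v (leftCreation J hα hq u f) := by
  induction f using induction_pure with
  | pure n x =>
    rw [creation_pure, leftCreation_pure, leftCreation_pure, creation_pure]
    exact congrArg (pure J hα hq) (Fin.cons_snoc_eq_snoc_cons u x v)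
  | smul c f hf => simp only [map_smul, hf]
  | add f g hf hg => simp only [map_add, hf, hg]

lemma leftCreation_vacuum (u : H) :
    leftCreation J hα hq u (vacuum J hα hq) = pure J hα hq ![u] := by
  rw [vacuum_eq_pure, leftCreation_pure]
  rfl

lemma leftAnnihilation_vacuum (u : H) : leftAnnihilation J hα hq u (vacuum J hα hq) = 0 := by
  rw [leftAnnihilation, LinearMap.comp_apply, LinearMap.comp_apply, flip_vacuum,
    annihilation_vacuum, map_zero]

end Algebraic

section AlphaZero

variable {J : SelfAdjointInvolution H} {q : ℝ} {h₀ : (0 : ℝ) ∈ Set.Ioo (-1 : ℝ) 1}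
  {hq : q ∈ Set.Ioo (-1 : ℝ) 1}

lemma annihilation_leftCreation_pure (u v : H) {n : ℕ} (x : Fin n → H) :
    annihilation J h₀ hq v (leftCreation J h₀ hq u (pure J h₀ hq x)) =
      leftCreation J h₀ hq u (annihilation J h₀ hq v (pure J h₀ hq x)) +
        inner ℂ v u • qPow J h₀ hq (pure J h₀ hq x) := by
  rw [leftCreation_pure, annihilation_pure_succ, Fin.sum_univ_succ, qPow_pure, add_comm,
    Fin.cons_zero, Fin.removeNth_zero, Fin.tail_cons, removalFunctional_apply, smul_smul]
  congr 1
  · cases n with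
    | zero => rw [annihilation_pure_zero, map_zero, Finset.univ_eq_empty, Finset.sum_empty]
    | succ n =>
      have hremove (k : Fin (n + 1)) : k.succ.removeNth (Fin.cons u x : Fin (n + 2) → H) =
        Fin.cons u (k.removeNth x) := Fin.cons_comp_succ_succAbove u x k
      simp only [annihilation_pure_succ, map_sum, map_smul, leftCreation_pure, Fin.cons_succ,
        hremove, removalFunctional_apply, Complex.ofReal_zero, zero_mul, add_zero, Fin.rev_succ,
        Fin.val_castSucc]
  · simp [mul_comm]

lemma annihilation_leftCreation (u v : H) (f : FockSpace J h₀ hq) :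
    annihilation J h₀ hq v (leftCreation J h₀ hq u f) =
      leftCreation J h₀ hq u (annihilation J h₀ hq v f) + inner ℂ v u • qPow J h₀ hq f := by
  induction f using induction_pure with
  | pure n x => exact annihilation_leftCreation_pure u v x
  | smul c f hf => simp only [map_smul, hf, smul_add, smul_comm c]
  | add f g hf hg =>
    simp only [map_add, hf, hg, smul_add]
    abel

lemma leftAnnihilation_creation (u v : H) (f : FockSpace J h₀ hq) :
    leftAnnihilation J h₀ hq u (creation J h₀ hq v f) =
      creation J h₀ hq v (leftAnnihilation J h₀ hq u f) + inner ℂ u v • qPow J h₀ hq f := by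
  have hmirror := congrArg (flip J h₀ hq) (annihilation_leftCreation v u (flip J h₀ hq f))
  simpa only [leftCreation, leftAnnihilation, LinearMap.comp_apply, flip_flip, map_add, map_smul,
    flip_qPow_flip] using hmirror

lemma inner_flip_flip (f g : FockSpace J h₀ hq) :
    inner ℂ (flip J h₀ hq f) (flip J h₀ hq g) = inner ℂ f g := by
  induction f using induction_pure with
  | smul c f hf => simp only [map_smul, inner_smul_left, hf]
  | add f f' hf hf' => simp only [map_add, inner_add_left, hf, hf']
  | pure m x =>
    induction g using induction_pure with
    | smul c f hf => simp only [map_smul, inner_smul_right, hf]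
    | add f f' hf hf' => simp only [map_add, inner_add_right, hf, hf']
    | pure n y =>
      rw [flip_pure, flip_pure]
      obtain rfl | hmn := eq_or_ne m n
      · rw [inner_pure, inner_pure, levelInner_zero_tprod_rev]
      · rw [inner_pure_of_ne hmn, inner_pure_of_ne hmn]

variable (J h₀ hq) in
/-- The unitary on the completed Fock space which extends `flip` for `α = 0`. -/
noncomputable def flipCLM : Completed J h₀ hq →L[ℂ] Completed J h₀ hq :=
  ((flip J h₀ hq).isometryOfInner inner_flip_flip).toContinuousLinearMap.completion

lemma flipCLM_coe (f : FockSpace J h₀ hq) :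
    flipCLM J h₀ hq f = (flip J h₀ hq f : FockSpace J h₀ hq) :=
  ContinuousLinearMap.completion_apply_coe _ f

lemma star_flipCLM : star (flipCLM J h₀ hq) = flipCLM J h₀ hq := by
  refine clm_ext fun f => ext_inner_left ℂ fun z => ?_
  induction z using UniformSpace.Completion.induction_on with
  | hp => exact isClosed_eq (by fun_prop) (by fun_prop)
  | ih g =>
    rw [ContinuousLinearMap.star_eq_adjoint, ContinuousLinearMap.adjoint_inner_right, flipCLM_coe,
      flipCLM_coe, UniformSpace.Completion.inner_coe, UniformSpace.Completion.inner_coe,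
      ← inner_flip_flip, flip_flip]

variable (J h₀ hq) in
/-- The bounded extension of left creation to the completed Fock space for `α = 0`. -/
noncomputable def leftCreationCLM (u : H) : Completed J h₀ hq →L[ℂ] Completed J h₀ hq :=
  flipCLM J h₀ hq * creationCLM J h₀ hq u * flipCLM J h₀ hq

lemma leftCreationCLM_coe (u : H) (f : FockSpace J h₀ hq) :
    leftCreationCLM J h₀ hq u f = (leftCreation J h₀ hq u f : FockSpace J h₀ hq) := by
  simp only [leftCreationCLM, mul_apply_eq_comp, flipCLM_coe, creationCLM_coe]
  rfl

lemma star_leftCreationCLM_coe (u : H) (f : FockSpace J h₀ hq) :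
    star (leftCreationCLM J h₀ hq u) f = (leftAnnihilation J h₀ hq u f : FockSpace J h₀ hq) := by
  simp only [leftCreationCLM, star_mul, star_flipCLM, mul_apply_eq_comp, flipCLM_coe,
    star_creationCLM_coe]
  rfl

lemma commute_creationCLM_leftCreationCLM (u v : H) :
    Commute (creationCLM J h₀ hq v) (leftCreationCLM J h₀ hq u) := clm_ext fun f => by
  simp only [mul_apply_eq_comp, leftCreationCLM_coe, creationCLM_coe, leftCreation_creation]

lemma creationCLM_mul_star_add_star_mul {u v : H} (huv : (inner ℂ u v : ℂ) = inner ℂ v u) :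
    creationCLM J h₀ hq v * star (leftCreationCLM J h₀ hq u) +
        star (creationCLM J h₀ hq v) * leftCreationCLM J h₀ hq u =
      star (leftCreationCLM J h₀ hq u) * creationCLM J h₀ hq v +
        leftCreationCLM J h₀ hq u * star (creationCLM J h₀ hq v) := clm_ext fun f => by
  simp only [add_apply, mul_apply_eq_comp, leftCreationCLM_coe, star_leftCreationCLM_coe,
    creationCLM_coe, star_creationCLM_coe, annihilation_leftCreation, leftAnnihilation_creation,
    huv, ← UniformSpace.Completion.coe_add]
  congr 1
  abel

variable (J h₀ hq) in
/-- The left counterpart of `gaussian` for `α = 0`. -/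
noncomputable def leftGaussian (u : H) : Completed J h₀ hq →L[ℂ] Completed J h₀ hq :=
  star (leftCreationCLM J h₀ hq u) + leftCreationCLM J h₀ hq u

lemma star_leftGaussian (u : H) : star (leftGaussian J h₀ hq u) = leftGaussian J h₀ hq u := by
  rw [leftGaussian, star_add, star_star, add_comm]

lemma leftGaussian_vacuum (u : H) :
    leftGaussian J h₀ hq u (vacuum J h₀ hq : Completed J h₀ hq) =
      gaussian J h₀ hq u (vacuum J h₀ hq : Completed J h₀ hq) := by
  rw [leftGaussian, add_apply, star_leftCreationCLM_coe, leftCreationCLM_coe,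
    leftAnnihilation_vacuum, leftCreation_vacuum, gaussian_vacuum,
    UniformSpace.Completion.coe_zero, zero_add]

lemma commute_gaussian_leftGaussian {u v : H} (huv : (inner ℂ u v : ℂ) = inner ℂ v u) :
    Commute (gaussian J h₀ hq v) (leftGaussian J h₀ hq u) := by
  have hcreation := commute_creationCLM_leftCreationCLM (J := J) (h₀ := h₀) (hq := hq) u v
  have hmixed := creationCLM_mul_star_add_star_mul (J := J) (h₀ := h₀) (hq := hq) huv
  have hgaussian : gaussian J h₀ hq v = star (creationCLM J h₀ hq v) + creationCLM J h₀ hq v := rfl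
  rw [hgaussian, leftGaussian]
  generalize creationCLM J h₀ hq v = C at *
  generalize leftCreationCLM J h₀ hq u = L at *
  calc (star C + C) * (star L + L)
      = star C * star L + (C * star L + star C * L) + C * L := by noncomm_ring
    _ = star L * star C + (star L * C + L * star C) + L * C := by
        rw [hmixed, hcreation.eq, hcreation.star_star.eq]
    _ = (star L + L) * (star C + C) := by noncomm_ring

end AlphaZero

end FockSpace

end OrderReversal

section Trace

variable {E : Type*} [NormedAddCommGroup E] [InnerProductSpace ℝ E]
  {J : SelfAdjointInvolution (Complexification E)}

open Complexification

namespace FockSpace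

section Cyclic

variable {α q : ℝ} {hα : α ∈ Set.Ioo (-1 : ℝ) 1} {hq : q ∈ Set.Ioo (-1 : ℝ) 1}
  {P : Submodule ℂ (FockSpace J hα hq)}

lemma creation_eq_re_add_im (u : Complexification E) : creation J hα hq u =
    creation J hα hq (ofReal u.re) + Complex.I • creation J hα hq (ofReal u.im) := by
  rw [← creation_smul, ← creation_add]
  congr 1
  ext <;> simp [ofReal]

lemma annihilation_pure_mem {n : ℕ} (h : ∀ m < n, ∀ y : Fin m → Complexification E,
    pure J hα hq y ∈ P) (u : Complexification E) (x : Fin n → Complexification E) :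
    annihilation J hα hq u (pure J hα hq x) ∈ P := by
  cases n with
  | zero => exact (annihilation_pure_zero u x).symm ▸ zero_mem P
  | succ n =>
    rw [annihilation_pure_succ]
    exact sum_mem fun k _ => P.smul_mem _ (h n n.lt_succ_self _)

lemma pure_mem (hvacuum : vacuum J hα hq ∈ P) (hgaussian : ∀ x : E, ∀ f ∈ P,
    annihilation J hα hq (ofReal x) f + creation J hα hq (ofReal x) f ∈ P) {n : ℕ}
    (v : Fin n → Complexification E) : pure J hα hq v ∈ P := by
  induction n using Nat.strong_induction_on with
  | _ n ih =>
    cases n with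
    | zero => exact Subsingleton.elim v Fin.elim0 ▸ hvacuum
    | succ n =>
      have creation_ofReal_mem (x : E) :
          creation J hα hq (ofReal x) (pure J hα hq (Fin.init v)) ∈ P :=
        (P.add_mem_iff_right (annihilation_pure_mem (fun m hm y => ih m (by omega) y) _ _)).1
          (hgaussian x _ (ih n n.lt_succ_self _))
      rw [← Fin.snoc_init_self v, ← creation_pure, creation_eq_re_add_im]
      exact P.add_mem (creation_ofReal_mem _) (P.smul_mem _ (creation_ofReal_mem _))

theorem dense_of_gaussian_apply_mem {P : Submodule ℂ (Completed J hα hq)}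
    (hvacuum : (vacuum J hα hq : Completed J hα hq) ∈ P)
    (hgaussian : ∀ x : E, ∀ z ∈ P, gaussian J hα hq (ofReal x) z ∈ P) :
    Dense (P : Set (Completed J hα hq)) := by
  let Q : Submodule ℂ (FockSpace J hα hq) :=
    P.comap (UniformSpace.Completion.toComplₗᵢ (𝕜 := ℂ)).toLinearMap
  have hpure {n : ℕ} (v : Fin n → Complexification E) : pure J hα hq v ∈ Q :=
    pure_mem hvacuum (fun x f hf => by
      have hmem := hgaussian x f hf
      rwa [gaussian_coe] at hmem) v
  refine UniformSpace.Completion.denseRange_coe.mono ?_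
  rintro _ ⟨f, rfl⟩
  change f ∈ Q
  induction f using induction_pure with
  | pure n x => exact hpure x
  | smul c f hf => exact Q.smul_mem c hf
  | add f g hf hg => exact Q.add_mem hf hg

end Cyclic

variable {q : ℝ} {h₀ : (0 : ℝ) ∈ Set.Ioo (-1 : ℝ) 1} {hq : q ∈ Set.Ioo (-1 : ℝ) 1}

lemma isCommutantPartner_gaussian_leftGaussian (x : E) :
    IsCommutantPartner
      (generatedVonNeumannAlgebra {G | ∃ x : E, IsGaussian J h₀ hq (ofReal x) G})
      (vacuum J h₀ hq : Completed J h₀ hq)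
      (gaussian J h₀ hq (ofReal x)) (leftGaussian J h₀ hq (ofReal x)) where
  mem := subset_generatedVonNeumannAlgebra _ ⟨x, (isGaussian_iff _ _).2 rfl⟩
  mem_commutant := mem_commutant_generatedVonNeumannAlgebra fun G ⟨y, hG⟩ => by
    have hcomm := commute_gaussian_leftGaussian (J := J) (h₀ := h₀) (hq := hq)
      (inner_ofReal_comm x y)
    rw [(isGaussian_iff _ _).1 hG, star_gaussian]
    exact ⟨hcomm, hcomm⟩
  apply_eq := leftGaussian_vacuum _
  star_apply_eq := by
    rw [star_leftGaussian, leftGaussian_vacuum, star_gaussian]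

theorem isTraceOn_vacuumState_zero :
    IsTraceOn (generatedVonNeumannAlgebra {G | ∃ x : E, IsGaussian J h₀ hq (ofReal x) G})
      (vacuumState J h₀ hq) :=
  isTraceOn_of_dense_partnerSubmodule <| dense_of_gaussian_apply_mem mem_partnerSubmodule_self
    fun x _ hz => (isCommutantPartner_gaussian_leftGaussian x).apply_mem_partnerSubmodule hz

end FockSpace

end Trace

end TypeB

theorem mainTheorem8_general {E : Type*} [NormedAddCommGroup E] [InnerProductSpace ℝ E]
    (hdim : 2 ≤ Module.rank ℝ E)
    (J : TypeB.SelfAdjointInvolution (TypeB.Complexification E))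
    {α q : ℝ} (hα : α ∈ Set.Ioo (-1 : ℝ) 1) (hq : q ∈ Set.Ioo (-1 : ℝ) 1) :
    (∀ x : E, ∃! G : TypeB.FockSpace.Completed J hα hq →L[ℂ] TypeB.FockSpace.Completed J hα hq,
      TypeB.FockSpace.IsGaussian J hα hq (TypeB.Complexification.ofReal x) G) ∧
    (TypeB.IsTraceOn
      (TypeB.generatedVonNeumannAlgebra
        {G | ∃ x : E, TypeB.FockSpace.IsGaussian J hα hq (TypeB.Complexification.ofReal x) G})
      (TypeB.FockSpace.vacuumState J hα hq) ↔ α = 0) := by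
  have hG := TypeB.FockSpace.isGaussian_iff (J := J) (hα := hα) (hq := hq)
  refine ⟨fun x => ⟨_, (hG _ _).2 rfl, fun G h => (hG _ G).1 h⟩, fun htr => ?_, ?_⟩
  · by_contra hα₀
    refine TypeB.FockSpace.not_isTraceOn_vacuumState hdim hα₀ (fun x => ?_) htr
    exact TypeB.subset_generatedVonNeumannAlgebra _ ⟨x, (hG _ _).2 rfl⟩
  · rintro rfl
    exact TypeB.FockSpace.isTraceOn_vacuumState_zero

theorem mainTheorem8 {E : Type*} [NormedAddCommGroup E] [InnerProductSpace ℝ E]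
    [CompleteSpace E] [TopologicalSpace.SeparableSpace E] (hdim : 2 ≤ Module.rank ℝ E)
    (J : TypeB.SelfAdjointInvolution (TypeB.Complexification E))
    {α q : ℝ} (hα : α ∈ Set.Ioo (-1 : ℝ) 1) (hq : q ∈ Set.Ioo (-1 : ℝ) 1) :
    (∀ x : E, ∃! G : TypeB.FockSpace.Completed J hα hq →L[ℂ] TypeB.FockSpace.Completed J hα hq,
      TypeB.FockSpace.IsGaussian J hα hq (TypeB.Complexification.ofReal x) G) ∧
    (TypeB.IsTraceOn
      (TypeB.generatedVonNeumannAlgebra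
        {G | ∃ x : E, TypeB.FockSpace.IsGaussian J hα hq (TypeB.Complexification.ofReal x) G})
      (TypeB.FockSpace.vacuumState J hα hq) ↔ α = 0) :=
  mainTheorem8_general hdim J hα hq
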